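/- Let $\mathcal H_1$ be a finite-dimensional Hilbert space, let $\mathcal H_0$ be a one-dimensional (vacuum) Hilbert space with its unique density operator $\tau_0$, let $\tau_1,\tau_1'$ be density operators on $\mathcal H_1$, and let $N,N'\ge 0$. For every $M$ (large enough that $N/M,N'/M\le 1$) put $$\rho_M=\Bigl[(1-\epsilon)\tau_0\oplus\epsilon\,\tau_1\Bigr]^{\otimes M},\quad \epsilon=\tfrac{N}{M},\qquad \rho_M'=\Bigl[(1-\epsilon')\tau_0\oplus\epsilon'\tau_1'\Bigr]^{\otimes M},\quad \epsilon'=\tfrac{N'}{M},$$ and let $\Gamma=N\tau_1$, $\Gamma'=N'\tau_1'$ be the intensity operators. For positive-semidefinite operators $A,B$ put $$F(A,B)=\operatorname{tr}\sqrt{\sqrt A\,B\sqrt A},\qquad C_s(A,B)=\operatorname{tr}A^sB^{1-s},\qquad D(A\|B)=\operatorname{tr}B-\operatorname{tr}A+\operatorname{tr}A(\ln A-\ln B),$$ where powers and logarithms are taken on the support (so $A^0$ is the projection onto the support of $A$) and $D(A\|B)=\infty$ if $\operatorname{supp}A\not\subseteq\operatorname{supp}B$. For countable families $p,q$ of nonnegative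 numbers put $$C_s(p,q)=\sum_i p_i^s q_i^{1-s},\qquad D(p\|q)=\sum_i\Bigl(q_i-p_i+p_i\ln\frac{p_i}{q_i}\Bigr)\in[0,\infty],$$ with $0^s=0$ for all $s$ (including $s=0$), $0\ln(0/q)=0$, and $p\ln(p/0)=\infty$ for $p>0$. The information quantities of the Poisson states $\rho,\rho'$ with intensity operators $\Gamma,\Gamma'$ are the limits $$F(\rho,\rho')=\lim_{M\to\infty}F(\rho_M,\rho_M'),\quad C_s(\rho,\rho')=\lim_{M\to\infty}C_s(\rho_M,\rho_M'),\quad D(\rho\|\rho')=\lim_{M\to\infty}D(\rho_M\|\rho_M')\in[0,\infty].$$ Let $(E_j)_{j\in J}$, with $J$ countable, be a POVM on $\mathcal H_1$, i.e. $E_j\ge 0$ and $\sum_jE_j=I$. Let $\Lambda_j=\operatorname{tr}E_j\Gamma$, $\Lambda_j'=\operatorname{tr}E_j\Gamma'$, and let $P_{\mathcal M},P_{\mathcal M}'$ be the Poisson counting distributions $$P_{\mathcal M}(m)=\prod_{j}e^{-\Lambda_j}\frac{\Lambda_j^{m_j}}{m_j!},\qquad P_{\mathcal M}'(m)=\prod_{j}e^{-\Lambda_j'}\frac{\Lambda_j'^{\,m_j}}{m_j!}$$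 on the finitely supported count vectors $m=(m_j)_{j\in J}$, $m_j\in\{0,1,2,\dots\}$. Then the three limits above exist, and for all $0\le s\le 1$ $$F(\rho,\rho')\le C_{1/2}(P_{\mathcal M},P_{\mathcal M}'),\qquad C_s(\rho,\rho')\le C_s(P_{\mathcal M},P_{\mathcal M}'),\qquad D(\rho\|\rho')\ge D(P_{\mathcal M}\|P_{\mathcal M}').$$ Moreover the same inequalities hold for the intensities: $$F(\Gamma,\Gamma')\le C_{1/2}(\Lambda,\Lambda'),\qquad C_s(\Gamma,\Gamma')\le C_s(\Lambda,\Lambda'),\qquad D(\Gamma\|\Gamma')\ge D(\Lambda\|\Lambda').$$ -/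

import Mathlib

open Filter Topology
open scoped ENNReal ComplexOrder

namespace PoissonQuantum

noncomputable section

/-! ### Quantum information quantities on positive-semidefinite matrices -/

/-- A density operator on `ℂ^n`: a positive-semidefinite matrix of unit trace. -/
def IsDensity {n : Type*} [Fintype n] (A : Matrix n n ℂ) : Prop :=
  A.PosSemidef ∧ A.trace = 1

/-- The power `x ^ s` taken on the support, i.e. `0 ^ s = 0` for every `s`, including `s = 0`.
For `s ≠ 0` this is the usual power of a nonnegative number. -/
def suppPow (s x : ℝ) : ℝ := if x = 0 then 0 else x ^ s

/-- The power `A ^ s` of a positive-semidefinite matrix, by functional calculus;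
`A ^ 0` is the orthogonal projection onto the support of `A`. -/
def mpow {n : Type*} [Fintype n] [DecidableEq n] (A : Matrix n n ℂ) (s : ℝ) : Matrix n n ℂ :=
  cfc (suppPow s) A

/-- The positive-semidefinite square root. -/
def msqrt {n : Type*} [Fintype n] [DecidableEq n] (A : Matrix n n ℂ) : Matrix n n ℂ :=
  cfc Real.sqrt A

/-- The logarithm of a positive-semidefinite matrix on its support, extended by `0` to the
kernel (as `Real.log 0 = 0`). -/
def mlog {n : Type*} [Fintype n] [DecidableEq n] (A : Matrix n n ℂ) : Matrix n n ℂ :=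
  cfc Real.log A

/-- The support of a Hermitian matrix: its range, the orthogonal complement of its kernel. -/
def supp {n : Type*} [Fintype n] (A : Matrix n n ℂ) : Submodule ℂ (n → ℂ) :=
  LinearMap.range A.mulVecLin

/-- Uhlmann fidelity `F(A, B) = tr √(√A B √A)`. -/
def fidelity {n : Type*} [Fintype n] [DecidableEq n] (A B : Matrix n n ℂ) : ℝ :=
  (msqrt (msqrt A * B * msqrt A)).trace.re

/-- Quantum Chernoff quantity `C_s(A, B) = tr A ^ s B ^ (1 - s)`. -/
def qChernoff {n : Type*} [Fintype n] [DecidableEq n] (s : ℝ) (A B : Matrix n n ℂ) : ℝ :=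
  (mpow A s * mpow B (1 - s)).trace.re

open Classical in
/-- Quantum relative entropy `D(A ‖ B) = tr B - tr A + tr A (ln A - ln B)` of (not necessarily
normalized) positive-semidefinite matrices; it is `∞` unless `supp A ⊆ supp B`. -/
def qRelEntropy {n : Type*} [Fintype n] [DecidableEq n] (A B : Matrix n n ℂ) : EReal :=
  if supp A ≤ supp B then
    ((B.trace.re - A.trace.re + (A * (mlog A - mlog B)).trace.re : ℝ) : EReal)
  else ⊤

/-! ### Classical information quantities on countable families of nonnegative numbers -/

/-- Classical Chernoff quantity `C_s(p, q) = ∑ i, p i ^ s * q i ^ (1 - s)`. -/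
def chernoff {ι : Type*} (s : ℝ) (p q : ι → ℝ) : ℝ :=
  ∑' i, suppPow s (p i) * suppPow (1 - s) (q i)

/-- The term `q - p + p ln (p / q)` of the relative entropy for `p, q ≥ 0` (it is nonnegative),
with value `∞` when `q = 0 < p` and `0` when `p = q = 0`. -/
def relEntropyTerm (p q : ℝ) : ℝ≥0∞ :=
  if q = 0 ∧ p ≠ 0 then ⊤ else ENNReal.ofReal (q - p + p * Real.log (p / q))

/-- Classical relative entropy `D(p ‖ q) = ∑ i, (q i - p i + p i ln (p i / q i))`. -/
def relEntropy {ι : Type*} (p q : ι → ℝ) : ℝ≥0∞ :=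
  ∑' i, relEntropyTerm (p i) (q i)

/-! ### Poisson states -/

/-- The state `τ = (1 - ε) τ₀ ⊕ ε τ₁` of one temporal mode on `H₀ ⊕ H₁`, where `H₀` is the
one-dimensional vacuum space and `τ₀` its only density operator. -/
def modeState {d : Type*} (ε : ℝ) (τ₁ : Matrix d d ℂ) : Matrix (Unit ⊕ d) (Unit ⊕ d) ℂ :=
  Matrix.fromBlocks (Matrix.of fun _ _ => ((1 - ε : ℝ) : ℂ)) 0 0 ((ε : ℂ) • τ₁)

/-- The tensor power `A ^ ⊗ M`, on the product basis of `(ℂ^n) ^ ⊗ M`. -/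
def tensorPow {n : Type*} (A : Matrix n n ℂ) (M : ℕ) : Matrix (Fin M → n) (Fin M → n) ℂ :=
  Matrix.of fun i j => ∏ k, A (i k) (j k)

/-- The `M`-mode state `ρ_M = τ ^ ⊗ M` with `ε = N / M`. A Poisson state with expected object
number `N` and one-object state `τ₁` is this sequence, with quantities evaluated in the
limit `M → ∞` at fixed `N`. -/
def rareState {d : Type*} (N : ℝ) (τ₁ : Matrix d d ℂ) (M : ℕ) :
    Matrix (Fin M → Unit ⊕ d) (Fin M → Unit ⊕ d) ℂ :=
  tensorPow (modeState (N / M) τ₁) M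

/-- The intensity operator `Γ = N τ₁`. -/
def intensityOp {d : Type*} (N : ℝ) (τ₁ : Matrix d d ℂ) : Matrix d d ℂ :=
  (N : ℂ) • τ₁

/-! ### Measurement -/

/-- A positive operator-valued measure with outcomes in `J`: `E j ≥ 0` and `∑ j, E j = 1`. -/
structure IsPOVM {J d : Type*} [Fintype d] [DecidableEq d] (E : J → Matrix d d ℂ) : Prop where
  posSemidef : ∀ j, (E j).PosSemidef
  hasSum_one : HasSum E 1

/-- The intensities `Λ j = tr (E j Γ)`. -/
def intensity {J d : Type*} [Fintype d] (E : J → Matrix d d ℂ) (Γ : Matrix d d ℂ) (j : J) : ℝ :=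
  (E j * Γ).trace.re

/-- The Poisson counting distribution `P(m) = ∏ j, exp (-Λ j) Λ j ^ m j / (m j)!`. The vector
`m` of counts has finitely many nonzero entries, since the total count is finite; for a
summable `Λ ≥ 0` all the probability is carried by such vectors. -/
def poissonDist {J : Type*} (Λ : J → ℝ) (m : J →₀ ℕ) : ℝ :=
  ∏' j, (Real.exp (-Λ j) * Λ j ^ m j / (Nat.factorial (m j) : ℝ))

end

end PoissonQuantum

open PoissonQuantum

/-!
All the quantities are governed by the Chernoff quantity. In eigenbases of `A` and `B`, with
overlaps `c i j`, one has `C_s(A, B) = ∑ (a i) ^ s (b j) ^ (1 - s) c i j`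
(`exists_qChernoff_eq`), so `C_s` is smooth in `s`. Its value at `s = 1` is `tr A` exactly when
`supp A ⊆ supp B` (`supp_le_supp_iff`), and then its derivative there is
`tr A (ln A - ln B)` (`hasDerivAt_qChernoff`). The relative entropy is thus the limit of
`(s tr A + (1 - s) tr B - C_s(A, B)) / (1 - s)` as `s ↑ 1`, and the same holds classically,
term by term (`tendsto_relEntropyTerm`).

*Limits.* Fidelity and `C_s` are multiplicative on tensor powers and additive on the blocks of
`(1 - ε) τ₀ ⊕ ε τ₁`, so they equal `((1 - N / M) ^ s (1 - N' / M) ^ (1 - s) + C / M) ^ M` and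
converge to `exp (-(s N + (1 - s) N') + C)`, with `C` the quantity of the intensity operators.
The relative entropy of the `M`-mode states follows by uniqueness of the derivative at `s = 1`,
and converges to that of the intensity operators. On the classical side the exponential series
in the variables `Λ j` gives the same exponential for `C_s(P, P')` (`chernoff_poissonDist`).

*Measurement.* `C_s(Γ, Γ') ≤ C_s(Λ, Λ')` follows for `0 < s < 1` by writing `p ^ s q ^ (1 - s)` as
an integral over `t` of parallel sums `p (t q) / (p + t q)`. The parallel sum is a minimum of a
quadratic form, and its quantum form is at most `tr X² A + t tr (1 - X)² B` for every Hermitian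
`X` (last clause of `exists_qChernoff_eq`); the choice
`X = ∑ x j E j`, with `x j` the classical minimizers, and Kadison's inequality
`X² ≤ ∑ (x j)² E j` compare the two (`IsPOVM.exists_trace_add_le`). The endpoints `s = 0, 1` are
limits. The fidelity bound is the Fuchs–Caves argument: polar decomposition and Cauchy–Schwarz
for each outcome. The relative entropy bounds follow from those on `C_s` by Fatou's lemma
(`relEntropy_le_of_tendsto`).
-/

namespace PoissonQuantum

open Matrix

/-! ### Tensor powers and functional calculus of Hermitian matrices -/

section

lemma tensorPow_mul {n : Type*} [Fintype n] (A B : Matrix n n ℂ) (M : ℕ) :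
    tensorPow (A * B) M = tensorPow A M * tensorPow B M := by
  ext i j
  simp only [tensorPow, of_apply, mul_apply, Finset.prod_univ_sum, Fintype.piFinset_univ,
    Finset.prod_mul_distrib]

lemma trace_tensorPow {n : Type*} [Fintype n] (A : Matrix n n ℂ) (M : ℕ) :
    (tensorPow A M).trace = A.trace ^ M := by
  simp only [trace, diag, tensorPow, of_apply]
  rw [← Fin.prod_const, Finset.prod_univ_sum, Fintype.piFinset_univ]

lemma conjTranspose_tensorPow {n : Type*} (A : Matrix n n ℂ) (M : ℕ) :
    (tensorPow A M)ᴴ = tensorPow Aᴴ M := by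
  ext i j
  simp [tensorPow, conjTranspose_apply]

lemma tensorPow_diagonal {n : Type*} [DecidableEq n] (a : n → ℂ) (M : ℕ) :
    tensorPow (diagonal a) M = diagonal fun i => ∏ k, a (i k) := by
  ext i j
  by_cases h : i = j
  · simp [tensorPow, h]
  · obtain ⟨k, hk⟩ := Function.ne_iff.mp h
    rw [diagonal_apply_ne _ h]
    exact Finset.prod_eq_zero (Finset.mem_univ k) (diagonal_apply_ne _ hk)

lemma tensorPow_one {n : Type*} [DecidableEq n] (M : ℕ) : tensorPow (1 : Matrix n n ℂ) M = 1 := by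
  rw [← diagonal_one, tensorPow_diagonal]; simp

variable {n m : Type*} [Fintype n] [DecidableEq n] [Fintype m] [DecidableEq m]

lemma exists_unitary_diagonal {A : Matrix n n ℂ} (hA : A.IsHermitian) :
    ∃ V : Matrix n n ℂ, V * Vᴴ = 1 ∧
      A = V * diagonal (fun i => ((hA.eigenvalues i : ℝ) : ℂ)) * Vᴴ := by
  refine ⟨hA.eigenvectorUnitary, ?_, ?_⟩
  · simpa [star_eq_conjTranspose] using Unitary.coe_mul_star_self hA.eigenvectorUnitary
  · conv_lhs => rw [hA.spectral_theorem, Unitary.conjStarAlgAut_apply]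
    rfl


/-- The functional calculus in any eigenbasis. On the finite spectrum every function agrees with a
polynomial, for which the formula is algebraic. -/
theorem cfc_conj_diagonal (f : ℝ → ℝ) {V : Matrix n n ℂ} (hV : V * Vᴴ = 1) (a : n → ℝ) :
    cfc f (V * diagonal (fun i => (a i : ℂ)) * Vᴴ) =
      V * diagonal (fun i => (f (a i) : ℂ)) * Vᴴ := by
  have hV' : Vᴴ * V = 1 := mul_eq_one_comm.mp hV
  set A := V * diagonal (fun i => (a i : ℂ)) * Vᴴ with hA
  have hAh : A.IsHermitian := by
    rw [hA]
    exact isHermitian_mul_mul_conjTranspose V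
      (isHermitian_diagonal_of_self_adjoint _ (by ext i; simp))
  have hfin : (spectrum ℝ A).Finite := A.finite_real_spectrum
  obtain ⟨q, hq⟩ : ∃ q : Polynomial ℝ, ∀ x ∈ hfin.toFinset ∪ Finset.univ.image a, q.eval x = f x :=
    ⟨Lagrange.interpolate (hfin.toFinset ∪ Finset.univ.image a) id f, fun x hx => by
      simpa using Lagrange.eval_interpolate_at_node (v := id) f Function.injective_id.injOn hx⟩
  have h1 : cfc f A = Polynomial.aeval A q := by
    rw [← cfc_polynomial (R := ℝ) (p := IsSelfAdjoint) q A hAh]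
    exact cfc_congr fun x hx => (hq x (by simp [hx])).symm
  rw [h1]
  have key : ∀ q : Polynomial ℝ, Polynomial.aeval A q =
      V * diagonal (fun i => ((q.eval (a i) : ℝ) : ℂ)) * Vᴴ := by
    intro q
    induction q using Polynomial.induction_on' with
    | add p q hp hq =>
      rw [map_add, hp, hq, ← add_mul, ← mul_add, diagonal_add]; simp
    | monomial k r =>
      have hpow : ∀ k : ℕ, A ^ k = V * diagonal (fun i => ((a i ^ k : ℝ) : ℂ)) * Vᴴ := by
        intro k
        induction k with
        | zero => simp [hV]
        | succ k ih =>
          rw [pow_succ, ih, hA]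
          calc _ = V * diagonal (fun i => ((a i ^ k : ℝ) : ℂ)) * (Vᴴ * V) *
              diagonal (fun i => (a i : ℂ)) * Vᴴ := by simp only [Matrix.mul_assoc]
            _ = _ := by
              rw [hV', Matrix.mul_one, Matrix.mul_assoc V, diagonal_mul_diagonal]
              simp [pow_succ]
      rw [Polynomial.aeval_monomial, hpow, Algebra.algebraMap_eq_smul_one, smul_one_mul,
        ← Matrix.smul_mul, ← Matrix.mul_smul]
      congr 2
      ext i j
      by_cases h : i = j <;> simp [diagonal, h]
  rw [key]
  congr 3
  ext i
  rw [hq _ (by simp)]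

lemma cfc_fromBlocks (f : ℝ → ℝ) {A : Matrix n n ℂ} {B : Matrix m m ℂ} (hA : A.IsHermitian)
    (hB : B.IsHermitian) :
    cfc f (fromBlocks A 0 0 B) = fromBlocks (cfc f A) 0 0 (cfc f B) := by
  obtain ⟨V, hV, hA'⟩ := exists_unitary_diagonal hA
  obtain ⟨W, hW, hB'⟩ := exists_unitary_diagonal hB
  set a := hA.eigenvalues
  set b := hB.eigenvalues
  have hU : fromBlocks V 0 0 W * (fromBlocks V 0 0 W)ᴴ = 1 := by
    simp [fromBlocks_conjTranspose, fromBlocks_multiply, hV, hW]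
  have h : ∀ g : ℝ → ℝ, fromBlocks (V * diagonal (fun i => (g (a i) : ℂ)) * Vᴴ) 0 0
      (W * diagonal (fun i => (g (b i) : ℂ)) * Wᴴ) =
      fromBlocks V 0 0 W * diagonal (fun i => (g (Sum.elim a b i) : ℂ)) *
        (fromBlocks V 0 0 W)ᴴ := by
    intro g
    have : diagonal (fun i => (g (Sum.elim a b i) : ℂ)) = fromBlocks
        (diagonal (fun i => (g (a i) : ℂ))) 0 0 (diagonal (fun i => (g (b i) : ℂ))) := by
      rw [fromBlocks_diagonal]; congr 1; ext i; cases i <;> rfl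
    rw [this]
    simp only [fromBlocks_conjTranspose, fromBlocks_multiply, Matrix.mul_zero, Matrix.zero_mul,
      add_zero, zero_add, conjTranspose_zero]
  have h1 := h id
  simp only [id] at h1
  rw [hA', hB', cfc_conj_diagonal f hV, cfc_conj_diagonal f hW, h, h1, cfc_conj_diagonal f hU]

lemma cfc_smul_arg (f : ℝ → ℝ) (r : ℝ) {A : Matrix n n ℂ} (hA : A.IsHermitian) :
    cfc f ((r : ℂ) • A) = cfc (fun x => f (r * x)) A := by
  obtain ⟨V, hV, hA'⟩ := exists_unitary_diagonal hA
  set a := hA.eigenvalues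
  have : (r : ℂ) • (V * diagonal (fun i => (a i : ℂ)) * Vᴴ) =
      V * diagonal (fun i => ((r * a i : ℝ) : ℂ)) * Vᴴ := by
    rw [← Matrix.smul_mul, ← Matrix.mul_smul]
    congr 2
    ext i j
    by_cases h : i = j <;> simp [diagonal, h]
  rw [hA', this, cfc_conj_diagonal f hV, cfc_conj_diagonal _ hV]

/-- A function that is multiplicative on nonnegative numbers commutes with tensor powers, since
the eigenvalues of `A ^ ⊗ M` are products of eigenvalues of `A`. -/
lemma cfc_tensorPow {f : ℝ → ℝ} (h1 : f 1 = 1)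
    (hf : ∀ x y, 0 ≤ x → 0 ≤ y → f (x * y) = f x * f y)
    {A : Matrix n n ℂ} (hA : A.PosSemidef) (M : ℕ) :
    cfc f (tensorPow A M) = tensorPow (cfc f A) M := by
  obtain ⟨V, hV, hA'⟩ := exists_unitary_diagonal hA.1
  have ha := hA.eigenvalues_nonneg
  set a := hA.1.eigenvalues
  have hU : tensorPow V M * (tensorPow V M)ᴴ = 1 := by
    rw [conjTranspose_tensorPow, ← tensorPow_mul, hV, tensorPow_one]
  have h : ∀ s : Finset (Fin M), ∀ i : Fin M → n, f (∏ k ∈ s, a (i k)) = ∏ k ∈ s, f (a (i k)) := by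
    intro s i
    induction s using Finset.cons_induction with
    | empty => simpa using h1
    | cons k s hk ih =>
      rw [Finset.prod_cons, Finset.prod_cons,
        hf _ _ (ha _) (Finset.prod_nonneg fun _ _ => ha _), ih]
  have hT : ∀ b : n → ℝ, tensorPow (V * diagonal (fun i => (b i : ℂ)) * Vᴴ) M =
      tensorPow V M * diagonal (fun i => ((∏ k, b (i k) : ℝ) : ℂ)) * (tensorPow V M)ᴴ := by
    intro b
    rw [tensorPow_mul, tensorPow_mul, tensorPow_diagonal, conjTranspose_tensorPow]
    push_cast; rfl
  rw [hA', cfc_conj_diagonal f hV, hT, hT, cfc_conj_diagonal f hU]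
  simp only [h]

lemma isHermitian_cfc (f : ℝ → ℝ) (A : Matrix n n ℂ) : (cfc f A).IsHermitian :=
  cfc_predicate (R := ℝ) (p := IsSelfAdjoint) f A

lemma posSemidef_cfc {f : ℝ → ℝ} {A : Matrix n n ℂ} (hA : A.PosSemidef)
    (hf : ∀ x, 0 ≤ x → 0 ≤ f x) : (cfc f A).PosSemidef := by
  obtain ⟨V, hV, hA'⟩ := exists_unitary_diagonal hA.1
  rw [hA', cfc_conj_diagonal f hV]
  exact (PosSemidef.diagonal fun i => by
    simpa using hf _ (hA.eigenvalues_nonneg i)).mul_mul_conjTranspose_same V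

lemma continuousOn_spectrum (f : ℝ → ℝ) (A : Matrix n n ℂ) : ContinuousOn f (spectrum ℝ A) :=
  A.finite_real_spectrum.continuousOn f

lemma cfc_mul_cfc (f g : ℝ → ℝ) (A : Matrix n n ℂ) :
    cfc f A * cfc g A = cfc (fun x => f x * g x) A :=
  (cfc_mul f g A (continuousOn_spectrum f A) (continuousOn_spectrum g A)).symm

lemma mul_cfc (f : ℝ → ℝ) {A : Matrix n n ℂ} (hA : A.IsHermitian) :
    A * cfc f A = cfc (fun x => x * f x) A := by
  rw [← cfc_mul_cfc (fun x => x) f A, cfc_id' ℝ A hA.isSelfAdjoint]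

lemma spectrum_nonneg {A : Matrix n n ℂ} (hA : A.PosSemidef) {x : ℝ} (hx : x ∈ spectrum ℝ A) :
    0 ≤ x := by
  rw [hA.1.spectrum_real_eq_range_eigenvalues] at hx
  obtain ⟨i, rfl⟩ := hx
  exact hA.eigenvalues_nonneg i

lemma cfc_eq_self {f : ℝ → ℝ} {A : Matrix n n ℂ} (hA : A.PosSemidef) (hf : ∀ x, 0 ≤ x → f x = x) :
    cfc f A = A := by
  conv_rhs => rw [← cfc_id ℝ A hA.1.isSelfAdjoint]
  exact cfc_congr fun x hx => hf x (spectrum_nonneg hA hx)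

lemma msqrt_mul_self {A : Matrix n n ℂ} (hA : A.PosSemidef) : msqrt A * msqrt A = A := by
  rw [msqrt, cfc_mul_cfc]
  exact cfc_eq_self hA fun x hx => Real.mul_self_sqrt hx

/-- The trace of a product in terms of the overlaps of the two frames; neither `V` nor `W` needs
to be unitary. -/
lemma trace_conj_diagonal_mul_conj_diagonal (V W : Matrix n n ℂ) (x y : n → ℝ) :
    (V * diagonal (fun i => (x i : ℂ)) * Vᴴ * (W * diagonal (fun i => (y i : ℂ)) * Wᴴ)).trace =
      ((∑ i, ∑ j, x i * y j * Complex.normSq ((Vᴴ * W) i j) : ℝ) : ℂ) := by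
  rw [Matrix.mul_assoc, Matrix.mul_assoc, trace_mul_comm]
  have : diagonal (fun i => (x i : ℂ)) * (Vᴴ * (W * diagonal (fun i => (y i : ℂ)) * Wᴴ)) * V =
      diagonal (fun i => (x i : ℂ)) * (Vᴴ * W) * diagonal (fun i => (y i : ℂ)) * (Vᴴ * W)ᴴ := by
    simp [Matrix.mul_assoc]
  rw [this, trace]
  push_cast
  refine Finset.sum_congr rfl fun i _ => ?_
  rw [diag_apply, mul_apply]
  refine Finset.sum_congr rfl fun j _ => ?_
  rw [mul_diagonal, diagonal_mul, conjTranspose_apply, Complex.normSq_eq_conj_mul_self]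
  simp; ring

lemma trace_cfc_mul_cfc {A B : Matrix n n ℂ} {V W : Matrix n n ℂ} (hV : V * Vᴴ = 1)
    (hW : W * Wᴴ = 1) {a b : n → ℝ} (hA : A = V * diagonal (fun i => (a i : ℂ)) * Vᴴ)
    (hB : B = W * diagonal (fun i => (b i : ℂ)) * Wᴴ) (f g : ℝ → ℝ) :
    (cfc f A * cfc g B).trace =
      ((∑ i, ∑ j, f (a i) * g (b j) * Complex.normSq ((Vᴴ * W) i j) : ℝ) : ℂ) := by
  rw [hA, hB, cfc_conj_diagonal f hV, cfc_conj_diagonal g hW, trace_conj_diagonal_mul_conj_diagonal]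

end

/-! ### Powers on the support -/

section

lemma suppPow_nonneg (s : ℝ) {x : ℝ} (hx : 0 ≤ x) : 0 ≤ suppPow s x := by
  unfold suppPow; split_ifs; exacts [le_rfl, Real.rpow_nonneg hx s]

@[simp] lemma suppPow_zero_right (s : ℝ) : suppPow s 0 = 0 := by simp [suppPow]

lemma suppPow_of_pos (s : ℝ) {x : ℝ} (hx : 0 < x) : suppPow s x = x ^ s := by
  simp [suppPow, hx.ne']

lemma suppPow_of_ne {s : ℝ} (hs : s ≠ 0) (x : ℝ) : suppPow s x = x ^ s := by
  by_cases hx : x = 0 <;> simp [suppPow, hx, Real.zero_rpow hs]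

@[simp] lemma suppPow_one (x : ℝ) : suppPow 1 x = x := by
  simp [suppPow_of_ne]

@[simp] lemma suppPow_one_right (s : ℝ) : suppPow s 1 = 1 := by simp [suppPow]

lemma suppPow_mul (s : ℝ) {x y : ℝ} (hx : 0 ≤ x) (hy : 0 ≤ y) :
    suppPow s (x * y) = suppPow s x * suppPow s y := by
  by_cases hx' : x = 0
  · simp [hx']
  by_cases hy' : y = 0
  · simp [hy']
  simp [suppPow, hx', hy', Real.mul_rpow hx hy]

lemma suppPow_mul_suppPow {s x : ℝ} (hx : 0 ≤ x) :
    suppPow s x * suppPow (1 - s) x = x := by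
  rcases hx.eq_or_lt with rfl | hx
  · simp
  · rw [suppPow_of_pos _ hx, suppPow_of_pos _ hx, ← Real.rpow_add hx]; simp

lemma hasDerivAt_suppPow_mul (p q s : ℝ) (hp : 0 ≤ p) (hq : 0 ≤ q) :
    HasDerivAt (fun s => suppPow s p * suppPow (1 - s) q)
      (suppPow s p * suppPow (1 - s) q * (Real.log p - Real.log q)) s := by
  rcases hp.eq_or_lt with rfl | hp
  · simpa using hasDerivAt_const s (0 : ℝ)
  rcases hq.eq_or_lt with rfl | hq
  · simpa using hasDerivAt_const s (0 : ℝ)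
  simp only [suppPow_of_pos _ hp, suppPow_of_pos _ hq]
  have h1 : HasDerivAt (fun s => p ^ s) (p ^ s * Real.log p) s := by
    simpa [mul_comm] using (hasDerivAt_id s).const_rpow hp
  have h2 : HasDerivAt (fun s => q ^ (1 - s)) (Real.log q * (-1) * q ^ (1 - s)) s :=
    ((hasDerivAt_id s).const_sub 1).const_rpow hq
  exact (h1.mul h2).congr_deriv (by ring)

/-- The weighted inequality of arithmetic and geometric means; it holds at `s = 0` and `s = 1` too,
where the left side may drop to `0`. -/
lemma suppPow_mul_suppPow_le {s p q : ℝ} (hs : 0 ≤ s) (hs1 : s ≤ 1) (hp : 0 ≤ p) (hq : 0 ≤ q) :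
    suppPow s p * suppPow (1 - s) q ≤ s * p + (1 - s) * q := by
  have h0 : 0 ≤ s * p + (1 - s) * q := by
    have := sub_nonneg.mpr hs1
    positivity
  rcases hp.eq_or_lt with rfl | hp
  · simpa using h0
  rcases hq.eq_or_lt with rfl | hq
  · simpa using h0
  rw [suppPow_of_pos _ hp, suppPow_of_pos _ hq]
  exact Real.geom_mean_le_arith_mean2_weighted hs (by linarith) hp.le hq.le (by ring)

variable {n m : Type*} [Fintype n] [DecidableEq n] [Fintype m] [DecidableEq m]

/-! ### Positivity and fidelity -/

lemma posSemidef_mpow {A : Matrix n n ℂ} (hA : A.PosSemidef) (s : ℝ) : (mpow A s).PosSemidef :=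
  posSemidef_cfc hA fun _ => suppPow_nonneg s

lemma posSemidef_msqrt {A : Matrix n n ℂ} (hA : A.PosSemidef) : (msqrt A).PosSemidef :=
  posSemidef_cfc hA fun _ _ => Real.sqrt_nonneg _

lemma posSemidef_msqrt_mul_mul_msqrt {A B : Matrix n n ℂ} (hA : A.PosSemidef)
    (hB : B.PosSemidef) : (msqrt A * B * msqrt A).PosSemidef := by
  have := hB.mul_mul_conjTranspose_same (msqrt A)
  rwa [(posSemidef_msqrt hA).1.eq] at this

lemma ofReal_fidelity {A B : Matrix n n ℂ} (hA : A.PosSemidef) (hB : B.PosSemidef) :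
    ((fidelity A B : ℝ) : ℂ) = (msqrt (msqrt A * B * msqrt A)).trace := by
  have h := posSemidef_msqrt_mul_mul_msqrt hA hB
  have h2 := (posSemidef_msqrt h).trace_nonneg
  exact (Complex.eq_re_of_ofReal_le (r := 0) (by simpa using h2)).symm

/-! ### Parallel sums and the Nussbaum–Szkoła representation -/

/-- The parallel sum `x y / (x + y)` of two nonnegative numbers, with value `0` at `(0, 0)`. It is
the minimum over `w` of `x |w|² + y |1 - w|²`. -/
noncomputable def parSum (x y : ℝ) : ℝ := x * y / (x + y)

lemma parSum_nonneg {x y : ℝ} (hx : 0 ≤ x) (hy : 0 ≤ y) : 0 ≤ parSum x y := by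
  unfold parSum; positivity

lemma parSum_le_left {x y : ℝ} (hx : 0 ≤ x) (hy : 0 ≤ y) : parSum x y ≤ x := by
  rw [parSum, mul_div_assoc]
  exact mul_le_of_le_one_right hx (div_le_one_of_le₀ (by linarith) (by positivity))

lemma parSum_mul_normSq_le {x y : ℝ} (hx : 0 ≤ x) (hy : 0 ≤ y) (z w : ℂ) :
    parSum x y * Complex.normSq z ≤ x * Complex.normSq w + y * Complex.normSq (z - w) := by
  rcases (add_nonneg hx hy).eq_or_lt with h | h
  · rw [parSum, ← h, div_zero, zero_mul]
    have := Complex.normSq_nonneg w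
    have := Complex.normSq_nonneg (z - w)
    positivity
  · rw [parSum, div_mul_eq_mul_div, div_le_iff₀ h]
    -- the difference of the two sides is `|x w - y (z - w)|²`
    have := Complex.normSq_nonneg ((x : ℂ) * w - y * (z - w))
    simp only [Complex.normSq_apply, Complex.sub_re, Complex.sub_im, Complex.re_ofReal_mul,
      Complex.im_ofReal_mul] at this ⊢
    nlinarith

/-- The minimum defining the parallel sum is attained at `y / (x + y)`. -/
lemma parSum_eq {x y : ℝ} (hx : 0 ≤ x) (hy : 0 ≤ y) :
    parSum x y = (y / (x + y)) ^ 2 * x + (1 - y / (x + y)) ^ 2 * y := by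
  rcases (add_nonneg hx hy).eq_or_lt with h | h
  · obtain ⟨rfl, rfl⟩ := (add_eq_zero_iff_of_nonneg hx hy).mp h.symm
    simp [parSum]
  · rw [parSum]; field_simp; ring

/-- The Nussbaum–Szkoła representation: with `a`, `b` the eigenvalues of `A`, `B` and `c` the
squared overlaps of eigenvectors, the quantum quantities are classical ones of the families
`a i * c i j` and `b j * c i j`. The last clause is the variational bound for the parallel sum, in matrix
form. -/
lemma exists_qChernoff_eq {A B : Matrix n n ℂ} (hA : A.PosSemidef) (hB : B.PosSemidef) :
    ∃ (a b : n → ℝ) (c : n → n → ℝ), (∀ i, 0 ≤ a i) ∧ (∀ i, 0 ≤ b i) ∧ (∀ i j, 0 ≤ c i j) ∧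
      (∀ s, qChernoff s A B = ∑ i, ∑ j, suppPow s (a i) * suppPow (1 - s) (b j) * c i j) ∧
      A.trace.re = ∑ i, ∑ j, a i * c i j ∧
      (A * (mlog A - mlog B)).trace.re =
        ∑ i, ∑ j, a i * (Real.log (a i) - Real.log (b j)) * c i j ∧
      ∀ t, 0 ≤ t → ∀ X : Matrix n n ℂ, X.IsHermitian → ∑ i, ∑ j, parSum (a i) (t * b j) * c i j ≤
        (X * X * A).trace.re + t * ((1 - X) * (1 - X) * B).trace.re := by
  obtain ⟨V, hV, hAV⟩ := exists_unitary_diagonal hA.1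
  obtain ⟨W, hW, hBW⟩ := exists_unitary_diagonal hB.1
  have h := trace_cfc_mul_cfc hV hW hAV hBW
  have ha := hA.eigenvalues_nonneg
  have hb := hB.eigenvalues_nonneg
  set a := hA.1.eigenvalues
  set b := hB.1.eigenvalues
  refine ⟨a, b, fun i j => Complex.normSq ((Vᴴ * W) i j), ha, hb,
    fun i j => Complex.normSq_nonneg _, fun s => ?_, ?_, ?_, fun t ht X hX => ?_⟩
  · rw [qChernoff, mpow, mpow, h, Complex.ofReal_re]
  · have := h id 1
    rw [cfc_id ℝ A hA.1.isSelfAdjoint, cfc_one ℝ B hB.1.isSelfAdjoint, mul_one] at this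
    rw [this, Complex.ofReal_re]
    simp
  · have h1 := h (fun x => x * Real.log x) 1
    have h2 := h id Real.log
    have h3 : A * mlog A = cfc (fun x => x * Real.log x) A := mul_cfc _ hA.1
    rw [cfc_one ℝ B hB.1.isSelfAdjoint, mul_one] at h1
    rw [cfc_id ℝ A hA.1.isSelfAdjoint] at h2
    rw [mul_sub, trace_sub, h3, h1, mlog, h2, Complex.sub_re, Complex.ofReal_re, Complex.ofReal_re,
      ← Finset.sum_sub_distrib]
    refine Finset.sum_congr rfl fun i _ => ?_
    rw [← Finset.sum_sub_distrib]
    refine Finset.sum_congr rfl fun j _ => ?_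
    simp; ring
  · have hone : ∀ Y U : Matrix n n ℂ, Y.IsHermitian → U * Uᴴ = 1 →
        Y * Y = Y * U * diagonal (fun _ => ((1 : ℝ) : ℂ)) * (Y * U)ᴴ := by
      intro Y U hY hU
      rw [Complex.ofReal_one, diagonal_one, Matrix.mul_one, conjTranspose_mul, hY.eq,
        Matrix.mul_assoc, ← Matrix.mul_assoc U, hU, Matrix.one_mul]
    have hX' : (1 - X).IsHermitian := isHermitian_one.sub hX
    have e1 : (X * X * A).trace.re = ∑ i, ∑ j, a i * Complex.normSq ((Vᴴ * X * W) i j) := by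
      rw [trace_mul_comm, hone X W hX hW, hAV, trace_conj_diagonal_mul_conj_diagonal,
        Complex.ofReal_re]
      simp [Matrix.mul_assoc]
    have e2 : ((1 - X) * (1 - X) * B).trace.re =
        ∑ i, ∑ j, b j * Complex.normSq ((Vᴴ * W) i j - (Vᴴ * X * W) i j) := by
      rw [hone _ V hX' hV, hBW, trace_conj_diagonal_mul_conj_diagonal, Complex.ofReal_re,
        conjTranspose_mul, hX'.eq]
      simp [Matrix.mul_sub, Matrix.sub_mul]
    rw [e1, e2, Finset.mul_sum, ← Finset.sum_add_distrib]
    refine Finset.sum_le_sum fun i _ => ?_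
    rw [Finset.mul_sum, ← Finset.sum_add_distrib]
    refine Finset.sum_le_sum fun j _ => ?_
    rw [← mul_assoc]
    exact parSum_mul_normSq_le (ha i) (mul_nonneg ht (hb j)) _ _

lemma ofReal_qChernoff {A B : Matrix n n ℂ} (hA : A.PosSemidef) (hB : B.PosSemidef) (s : ℝ) :
    ((qChernoff s A B : ℝ) : ℂ) = (mpow A s * mpow B (1 - s)).trace := by
  obtain ⟨V, hV, hAV⟩ := exists_unitary_diagonal hA.1
  obtain ⟨W, hW, hBW⟩ := exists_unitary_diagonal hB.1
  rw [qChernoff, mpow, mpow, trace_cfc_mul_cfc hV hW hAV hBW, Complex.ofReal_re]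

lemma qChernoff_nonneg {A B : Matrix n n ℂ} (hA : A.PosSemidef) (hB : B.PosSemidef) (s : ℝ) :
    0 ≤ qChernoff s A B := by
  obtain ⟨a, b, c, ha, hb, hc, h, -⟩ := exists_qChernoff_eq hA hB
  rw [h]
  exact Finset.sum_nonneg fun i _ => Finset.sum_nonneg fun j _ =>
    mul_nonneg (mul_nonneg (suppPow_nonneg _ (ha i)) (suppPow_nonneg _ (hb j))) (hc i j)

lemma continuous_qChernoff {A B : Matrix n n ℂ} (hA : A.PosSemidef) (hB : B.PosSemidef) :
    Continuous fun s => qChernoff s A B := by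
  obtain ⟨a, b, c, ha, hb, hc, h, -⟩ := exists_qChernoff_eq hA hB
  simp only [h]
  refine continuous_finsetSum _ fun i _ => continuous_finsetSum _ fun j _ => ?_
  exact (continuous_iff_continuousAt.mpr fun s =>
    (hasDerivAt_suppPow_mul _ _ s (ha i) (hb j)).continuousAt).mul continuous_const

lemma qChernoff_one_le {A B : Matrix n n ℂ} (hA : A.PosSemidef) (hB : B.PosSemidef) :
    qChernoff 1 A B ≤ A.trace.re := by
  obtain ⟨a, b, c, ha, hb, hc, h, h1, -⟩ := exists_qChernoff_eq hA hB
  rw [h, h1]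
  refine Finset.sum_le_sum fun i _ => Finset.sum_le_sum fun j _ =>
    mul_le_mul_of_nonneg_right ?_ (hc i j)
  simpa using suppPow_mul_suppPow_le zero_le_one le_rfl (ha i) (hb j)

/-- When `supp A ⊆ supp B`, the derivative of `C_s(A, B)` at `s = 1` is `tr A (ln A - ln B)`. The
hypothesis makes `a i * c i j` vanish wherever `b j = 0`, so that the conventions at `0` agree. -/
lemma hasDerivAt_qChernoff {A B : Matrix n n ℂ} (hA : A.PosSemidef) (hB : B.PosSemidef)
    (h1 : qChernoff 1 A B = A.trace.re) :
    HasDerivAt (fun s => qChernoff s A B) (A * (mlog A - mlog B)).trace.re 1 := by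
  obtain ⟨a, b, c, ha, hb, hc, h, htr, hlog, -⟩ := exists_qChernoff_eq hA hB
  simp only [h] at h1 ⊢
  rw [htr] at h1
  have hle : ∀ i j, suppPow 1 (a i) * suppPow (1 - 1) (b j) * c i j ≤ a i * c i j := fun i j =>
    mul_le_mul_of_nonneg_right
     (by simpa using suppPow_mul_suppPow_le zero_le_one le_rfl (ha i) (hb j)) (hc i j)
  have heq : ∀ i j, suppPow 1 (a i) * suppPow (1 - 1) (b j) * c i j = a i * c i j := by
    intro i j
    have := (Finset.sum_eq_sum_iff_of_le fun i _ => Finset.sum_le_sum fun j _ => hle i j).mp h1 i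
      (Finset.mem_univ i)
    exact (Finset.sum_eq_sum_iff_of_le fun j _ => hle i j).mp this j (Finset.mem_univ j)
  rw [hlog]
  refine HasDerivAt.fun_sum fun i _ => HasDerivAt.fun_sum fun j _ => ?_
  exact ((hasDerivAt_suppPow_mul _ _ 1 (ha i) (hb j)).mul_const (c i j)).congr_deriv
    (by linear_combination (Real.log (a i) - Real.log (b j)) * heq i j)

/-- With `Q` the projection onto `supp B` one has `C_1(A, B) = tr A Q`, and `tr A (1 - Q)` vanishes
exactly when `Q A = A`. -/
lemma supp_le_supp_iff {A B : Matrix n n ℂ} (hA : A.PosSemidef) (hB : B.PosSemidef) :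
    supp A ≤ supp B ↔ qChernoff 1 A B = A.trace.re := by
  set Q := mpow B 0 with hQ
  have hQB : Q * B = B := by
    conv_lhs => rw [← cfc_id' ℝ B hB.1.isSelfAdjoint]
    rw [hQ, mpow, cfc_mul_cfc]
    refine cfc_eq_self hB fun x hx => ?_
    simpa [mul_comm] using suppPow_mul_suppPow (s := 1) hx
  have hQB' : Q = B * cfc (fun x : ℝ => x⁻¹) B := by
    rw [mul_cfc _ hB.1, hQ, mpow]
    congr 1
    ext x
    by_cases hx : x = 0 <;> simp [suppPow, hx]
  have hQQ : Q * Q = Q := by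
    rw [hQ, mpow, cfc_mul_cfc]
    congr 1
    ext x
    by_cases hx : x = 0 <;> simp [suppPow, hx]
  have hP : (1 - Q) * (1 - Q) = 1 - Q := by simp [sub_mul, mul_sub, hQQ]
  have hQh : Qᴴ = Q := (posSemidef_mpow hB 0).1
  have hC : qChernoff 1 A B = (A * Q).trace.re := by
    have : mpow A 1 = A := cfc_eq_self hA fun x _ => suppPow_one x
    rw [qChernoff, this, sub_self]
  rw [hC]
  constructor
  · intro h
    have hQA : Q * A = A := by
      refine ext_of_mulVec_single fun i => ?_
      obtain ⟨w, hw⟩ := h ⟨Pi.single i 1, rfl⟩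
      simp only [mulVecLin_apply] at hw
      rw [← mulVec_mulVec, ← hw, mulVec_mulVec, hQB]
    rw [trace_mul_comm, hQA]
  · intro h
    -- `tr A (1 - Q)` is the squared Frobenius norm of `√A (1 - Q)`
    have hs := (posSemidef_msqrt hA).1
    have h0 : msqrt A * (1 - Q) = 0 := by
      rw [← trace_conjTranspose_mul_self_eq_zero_iff]
      have e : ((msqrt A * (1 - Q))ᴴ * (msqrt A * (1 - Q))).trace = (A * (1 - Q)).trace := by
        rw [conjTranspose_mul, hs.eq, conjTranspose_sub, hQh, conjTranspose_one,
          trace_mul_comm]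
        calc _ = (msqrt A * ((1 - Q) * (1 - Q)) * msqrt A).trace := by
              simp only [Matrix.mul_assoc]
          _ = _ := by
              rw [trace_mul_comm, ← Matrix.mul_assoc, msqrt_mul_self hA, hP]
      have hp := (posSemidef_conjTranspose_mul_self (msqrt A * (1 - Q))).trace_nonneg
      rw [e] at hp ⊢
      rw [Complex.nonneg_iff] at hp
      refine Complex.ext ?_ hp.2.symm
      rw [mul_sub, trace_sub, Complex.sub_re, h]
      simp
    have hA0 : A = A * Q := by
      have := congrArg (msqrt A * ·) h0
      simp only [← Matrix.mul_assoc, msqrt_mul_self hA, Matrix.mul_zero] at this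
      rw [mul_sub, mul_one, sub_eq_zero] at this
      exact this
    have hA1 : A = Q * A := by
      have := congrArg conjTranspose hA0
      rwa [conjTranspose_mul, hQh, hA.1.eq] at this
    rintro _ ⟨v, rfl⟩
    refine ⟨(cfc (fun x : ℝ => x⁻¹) B * A) *ᵥ v, ?_⟩
    simp only [mulVecLin_apply]
    rw [mulVec_mulVec, ← Matrix.mul_assoc, ← hQB', ← hA1]

/-! ### Tensor powers, scalings and direct sums -/

lemma posSemidef_tensorPow {A : Matrix n n ℂ} (hA : A.PosSemidef) (M : ℕ) :
    (tensorPow A M).PosSemidef := by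
  rw [← msqrt_mul_self hA, tensorPow_mul]
  have := posSemidef_conjTranspose_mul_self (tensorPow (msqrt A) M)
  rwa [conjTranspose_tensorPow, (posSemidef_msqrt hA).1.eq] at this

lemma mpow_tensorPow {A : Matrix n n ℂ} (hA : A.PosSemidef) (s : ℝ) (M : ℕ) :
    mpow (tensorPow A M) s = tensorPow (mpow A s) M :=
  cfc_tensorPow (suppPow_one_right s) (fun _ _ => suppPow_mul s) hA M

lemma msqrt_tensorPow {A : Matrix n n ℂ} (hA : A.PosSemidef) (M : ℕ) :
    msqrt (tensorPow A M) = tensorPow (msqrt A) M :=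
  cfc_tensorPow Real.sqrt_one (fun _ _ hx _ => Real.sqrt_mul hx _) hA M

lemma qChernoff_tensorPow {A B : Matrix n n ℂ} (hA : A.PosSemidef) (hB : B.PosSemidef) (s : ℝ)
    (M : ℕ) : qChernoff s (tensorPow A M) (tensorPow B M) = qChernoff s A B ^ M := by
  apply Complex.ofReal_injective
  rw [ofReal_qChernoff (posSemidef_tensorPow hA M) (posSemidef_tensorPow hB M),
    mpow_tensorPow hA, mpow_tensorPow hB, ← tensorPow_mul, trace_tensorPow, Complex.ofReal_pow,
    ofReal_qChernoff hA hB]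

lemma fidelity_tensorPow {A B : Matrix n n ℂ} (hA : A.PosSemidef) (hB : B.PosSemidef)
    (M : ℕ) : fidelity (tensorPow A M) (tensorPow B M) = fidelity A B ^ M := by
  apply Complex.ofReal_injective
  have h := posSemidef_msqrt_mul_mul_msqrt hA hB
  rw [ofReal_fidelity (posSemidef_tensorPow hA M) (posSemidef_tensorPow hB M),
    msqrt_tensorPow hA, ← tensorPow_mul, ← tensorPow_mul, msqrt_tensorPow h, trace_tensorPow,
    Complex.ofReal_pow, ofReal_fidelity hA hB]

lemma mpow_smul {A : Matrix n n ℂ} (hA : A.PosSemidef) {r : ℝ} (hr : 0 ≤ r) (s : ℝ) :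
    mpow ((r : ℂ) • A) s = ((suppPow s r : ℝ) : ℂ) • mpow A s := by
  rw [mpow, cfc_smul_arg _ _ hA.1, mpow, Complex.coe_smul,
    ← cfc_smul (suppPow s r) (suppPow s) A (continuousOn_spectrum _ _)]
  exact cfc_congr fun x hx => suppPow_mul s hr (spectrum_nonneg hA hx)

lemma msqrt_smul {A : Matrix n n ℂ} (hA : A.PosSemidef) {r : ℝ} (hr : 0 ≤ r) :
    msqrt ((r : ℂ) • A) = ((√r : ℝ) : ℂ) • msqrt A := by
  rw [msqrt, cfc_smul_arg _ _ hA.1, msqrt, Complex.coe_smul,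
    ← cfc_smul (√r) Real.sqrt A (continuousOn_spectrum _ _)]
  exact cfc_congr fun x hx => Real.sqrt_mul hr x

lemma qChernoff_smul {A B : Matrix n n ℂ} (hA : A.PosSemidef) (hB : B.PosSemidef) {r : ℝ}
    (hr : 0 ≤ r) (s : ℝ) : qChernoff s ((r : ℂ) • A) ((r : ℂ) • B) = r * qChernoff s A B := by
  apply Complex.ofReal_injective
  rw [qChernoff, mpow_smul hA hr, mpow_smul hB hr, smul_mul_smul_comm, trace_smul,
    Complex.ofReal_mul,
    ofReal_qChernoff hA hB, ← Complex.ofReal_mul, suppPow_mul_suppPow hr, smul_eq_mul,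
    ← ofReal_qChernoff hA hB, ← Complex.ofReal_mul, Complex.ofReal_re]

lemma fidelity_smul {A B : Matrix n n ℂ} (hA : A.PosSemidef) (hB : B.PosSemidef) {r : ℝ}
    (hr : 0 ≤ r) : fidelity ((r : ℂ) • A) ((r : ℂ) • B) = r * fidelity A B := by
  have h := posSemidef_msqrt_mul_mul_msqrt hA hB
  rw [fidelity, fidelity, msqrt_smul hA hr, smul_mul_smul_comm, smul_mul_smul_comm]
  have e : ((√r : ℝ) : ℂ) * r * (√r : ℝ) = ((r * r : ℝ) : ℂ) := by
    rw [mul_right_comm, ← Complex.ofReal_mul, Real.mul_self_sqrt hr, Complex.ofReal_mul]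
  rw [e, msqrt_smul h (mul_nonneg hr hr), Real.sqrt_mul_self hr, trace_smul, smul_eq_mul,
    Complex.re_ofReal_mul]

lemma trace_fromBlocks_diag {n m : Type*} [Fintype n] [Fintype m] (A : Matrix n n ℂ)
    (B : Matrix m m ℂ) :
    (fromBlocks A 0 0 B).trace = A.trace + B.trace := by
  simp [trace]

lemma cfc_scalar (f : ℝ → ℝ) (r : ℝ) :
    cfc f (of fun _ _ => (r : ℂ) : Matrix Unit Unit ℂ) = of fun _ _ => ((f r : ℝ) : ℂ) := by
  have h : ∀ r : ℝ, (of fun _ _ => (r : ℂ) : Matrix Unit Unit ℂ) =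
      1 * diagonal (fun _ => (r : ℂ)) * 1ᴴ := by
    intro r; ext i j; simp
  rw [h, cfc_conj_diagonal f (by simp), h]

lemma isHermitian_scalar (r : ℝ) : (of fun _ _ => (r : ℂ) : Matrix Unit Unit ℂ).IsHermitian := by
  ext i j; simp

lemma posSemidef_modeState {ε : ℝ} (h0 : 0 ≤ ε) (h1 : ε ≤ 1) {τ : Matrix n n ℂ}
    (hτ : τ.PosSemidef) : (modeState ε τ).PosSemidef := by
  have hτ' : ((ε : ℂ) • τ).PosSemidef := hτ.smul (by exact_mod_cast h0)
  have : modeState ε τ = cfc (fun x => √x) (modeState ε τ) * cfc (fun x => √x) (modeState ε τ) := by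
    rw [modeState, cfc_fromBlocks _ (isHermitian_scalar _) hτ'.1, cfc_scalar,
      fromBlocks_multiply]
    have h2 := msqrt_mul_self hτ'
    rw [msqrt] at h2
    simp only [Matrix.mul_zero, Matrix.zero_mul, add_zero, zero_add]
    congr 1
    · ext i j
      simp only [of_apply, mul_apply, Finset.univ_unique, Finset.sum_const, Finset.card_singleton,
        one_smul]
      rw [← Complex.ofReal_mul, Real.mul_self_sqrt (by linarith)]
    · exact h2.symm
  rw [this]
  have h3 := posSemidef_conjTranspose_mul_self (cfc (fun x => √x) (modeState ε τ))
  rwa [(isHermitian_cfc _ _).eq] at h3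

lemma trace_modeState {n : Type*} [Fintype n] (ε : ℝ) {τ : Matrix n n ℂ} (hτ : τ.trace = 1) :
    (modeState ε τ).trace = 1 := by
  rw [modeState, trace_fromBlocks_diag, trace_smul, hτ]
  simp [trace]

lemma qChernoff_modeState {ε ε' : ℝ} (h0 : 0 ≤ ε) (h0' : 0 ≤ ε')
    {τ τ' : Matrix n n ℂ} (hτ : τ.PosSemidef) (hτ' : τ'.PosSemidef) (s : ℝ) :
    qChernoff s (modeState ε τ) (modeState ε' τ') =
      suppPow s (1 - ε) * suppPow (1 - s) (1 - ε') + qChernoff s ((ε : ℂ) • τ) ((ε' : ℂ) • τ') := by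
  have h : ((ε : ℂ) • τ).PosSemidef := hτ.smul (by exact_mod_cast h0)
  have h' : ((ε' : ℂ) • τ').PosSemidef := hτ'.smul (by exact_mod_cast h0')
  rw [qChernoff, mpow, mpow, modeState, modeState, cfc_fromBlocks _ (isHermitian_scalar _) h.1,
    cfc_fromBlocks _ (isHermitian_scalar _) h'.1, cfc_scalar, cfc_scalar, fromBlocks_multiply]
  simp only [Matrix.mul_zero, Matrix.zero_mul, add_zero, zero_add]
  rw [trace_fromBlocks_diag, Complex.add_re, qChernoff, mpow, mpow]
  congr 1
  simp [trace, mul_apply]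

lemma fidelity_modeState {ε ε' : ℝ} (h0 : 0 ≤ ε) (h0' : 0 ≤ ε') (h1 : ε ≤ 1)
    {τ τ' : Matrix n n ℂ} (hτ : τ.PosSemidef) (hτ' : τ'.PosSemidef) :
    fidelity (modeState ε τ) (modeState ε' τ') =
      √(1 - ε) * √(1 - ε') + fidelity ((ε : ℂ) • τ) ((ε' : ℂ) • τ') := by
  have h : ((ε : ℂ) • τ).PosSemidef := hτ.smul (by exact_mod_cast h0)
  have h' : ((ε' : ℂ) • τ').PosSemidef := hτ'.smul (by exact_mod_cast h0')
  have h2 := posSemidef_msqrt_mul_mul_msqrt h h'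
  have e : (of fun _ _ => ((√(1 - ε) : ℝ) : ℂ) : Matrix Unit Unit ℂ) *
      (of fun _ _ => ((1 - ε' : ℝ) : ℂ)) * (of fun _ _ => ((√(1 - ε) : ℝ) : ℂ)) =
      of fun _ _ => (((1 - ε) * (1 - ε') : ℝ) : ℂ) := by
    ext i j
    simp only [of_apply, mul_apply, Finset.univ_unique, Finset.sum_const, Finset.card_singleton,
      one_smul]
    rw [← Complex.ofReal_mul, ← Complex.ofReal_mul, mul_right_comm,
      Real.mul_self_sqrt (by linarith)]
  have hm : msqrt (modeState ε τ) = fromBlocks (of fun _ _ => ((√(1 - ε) : ℝ) : ℂ)) 0 0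
      (msqrt ((ε : ℂ) • τ)) := by
    rw [msqrt, modeState, cfc_fromBlocks _ (isHermitian_scalar _) h.1, cfc_scalar]; rfl
  rw [fidelity, hm, modeState, fromBlocks_multiply, fromBlocks_multiply]
  simp only [Matrix.mul_zero, Matrix.zero_mul, add_zero, zero_add]
  rw [e, msqrt, cfc_fromBlocks _ (isHermitian_scalar _) h2.1, cfc_scalar, trace_fromBlocks_diag,
    Complex.add_re, fidelity, Real.sqrt_mul (by linarith)]
  congr 1
  simp [trace]

end

/-! ### The limit of infinitely many modes -/

section

lemma tendsto_nat_mul_sub_of_hasDerivAt {f : ℝ → ℝ} {f' : ℝ} (hf : HasDerivAt f f' 0) :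
    Tendsto (fun M : ℕ => (M : ℝ) * (f (1 / M) - f 0)) atTop (𝓝 f') := by
  have h := hf.tendsto_slope_zero
  have h2 : Tendsto (fun M : ℕ => 1 / (M : ℝ)) atTop (𝓝[≠] 0) := by
    rw [tendsto_nhdsWithin_iff]
    refine ⟨tendsto_one_div_atTop_nhds_zero_nat, ?_⟩
    filter_upwards [eventually_gt_atTop 0] with M hM
    simp [hM.ne']
  refine (h.comp h2).congr fun M => ?_
  simp

lemma hasDerivAt_one_sub_mul (N : ℝ) : HasDerivAt (fun x : ℝ => 1 - N * x) (-N) 0 := by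
  simpa using ((hasDerivAt_id (0 : ℝ)).const_mul N).const_sub 1

lemma eventually_div_lt_one (N : ℝ) : ∀ᶠ M : ℕ in atTop, 0 < M ∧ N / M < 1 := by
  filter_upwards [eventually_gt_atTop 0, eventually_gt_atTop ⌈N⌉₊] with M h0 h1
  have : (0 : ℝ) < M := by exact_mod_cast h0
  exact ⟨h0, (div_lt_one this).mpr ((Nat.le_ceil N).trans_lt (by exact_mod_cast h1))⟩

/-- The vacuum contributes the normalization: the `M`-th power of the one-mode quantity converges to
an exponential. -/
lemma tendsto_vacuum_pow (N N' s C : ℝ) :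
    Tendsto (fun M : ℕ => ((1 - N / M) ^ s * (1 - N' / M) ^ (1 - s) + 1 / M * C : ℝ) ^ M) atTop
      (𝓝 (Real.exp (-(s * N + (1 - s) * N') + C))) := by
  have hd : HasDerivAt (fun x : ℝ => (1 - N * x) ^ s * (1 - N' * x) ^ (1 - s) + x * C)
      (-(s * N + (1 - s) * N') + C) 0 := by
    have h1 := (hasDerivAt_one_sub_mul N).rpow_const (p := s) (by simp)
    have h2 := (hasDerivAt_one_sub_mul N').rpow_const (p := 1 - s) (by simp)
    refine ((h1.mul h2).add ((hasDerivAt_id 0).mul_const C)).congr_deriv ?_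
    simp; ring
  have h := tendsto_nat_mul_sub_of_hasDerivAt hd
  have h2 := Real.tendsto_one_add_pow_exp_of_tendsto h
  refine h2.congr fun M => ?_
  congr 1
  simp [div_eq_mul_inv]

variable {d : Type*} [Fintype d] [DecidableEq d] {N N' : ℝ} {τ τ' : Matrix d d ℂ}

omit [DecidableEq d] in
lemma IsDensity.posSemidef_intensityOp (hτ : IsDensity τ) (hN : 0 ≤ N) :
    (intensityOp N τ).PosSemidef :=
  hτ.1.smul (by exact_mod_cast hN)

omit [DecidableEq d] in
lemma IsDensity.trace_intensityOp (hτ : IsDensity τ) (N : ℝ) : (intensityOp N τ).trace = N := by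
  simp [intensityOp, hτ.2]

lemma smul_div_eq_smul_intensityOp {d : Type*} (N : ℝ) (τ : Matrix d d ℂ) (M : ℕ) :
    ((N / M : ℝ) : ℂ) • τ = ((1 / M : ℝ) : ℂ) • intensityOp N τ := by
  rw [intensityOp, smul_smul]; congr 1; push_cast; ring

/-- For all `M` with `N / M, N' / M < 1`, so that the powers of the vacuum weights carry no junk
value. -/
lemma eventually_qChernoff_rareState (hN : 0 ≤ N) (hN' : 0 ≤ N') (hτ : IsDensity τ)
    (hτ' : IsDensity τ') :
    ∀ᶠ M : ℕ in atTop, ∀ s : ℝ, qChernoff s (rareState N τ M) (rareState N' τ' M) =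
      ((1 - N / M) ^ s * (1 - N' / M) ^ (1 - s) +
        1 / M * qChernoff s (intensityOp N τ) (intensityOp N' τ')) ^ M := by
  filter_upwards [eventually_div_lt_one N, eventually_div_lt_one N'] with M ⟨hM, h1⟩ ⟨_, h1'⟩ s
  rw [rareState, rareState, qChernoff_tensorPow (posSemidef_modeState (by positivity) h1.le hτ.1)
    (posSemidef_modeState (by positivity) h1'.le hτ'.1),
    qChernoff_modeState (by positivity) (by positivity) hτ.1 hτ'.1,
    smul_div_eq_smul_intensityOp N τ, smul_div_eq_smul_intensityOp N' τ',
    qChernoff_smul (hτ.posSemidef_intensityOp hN) (hτ'.posSemidef_intensityOp hN') (by positivity),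
    suppPow_of_pos _ (by linarith), suppPow_of_pos _ (by linarith)]

theorem tendsto_qChernoff_rareState (hN : 0 ≤ N) (hN' : 0 ≤ N') (hτ : IsDensity τ)
    (hτ' : IsDensity τ') (s : ℝ) :
    Tendsto (fun M : ℕ => qChernoff s (rareState N τ M) (rareState N' τ' M)) atTop
      (𝓝 (Real.exp (-(s * N + (1 - s) * N') +
        qChernoff s (intensityOp N τ) (intensityOp N' τ')))) := by
  refine (tendsto_vacuum_pow N N' s _).congr' ?_
  filter_upwards [eventually_qChernoff_rareState hN hN' hτ hτ'] with M hM
  rw [hM]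

theorem tendsto_fidelity_rareState (hN : 0 ≤ N) (hN' : 0 ≤ N') (hτ : IsDensity τ)
    (hτ' : IsDensity τ') :
    Tendsto (fun M : ℕ => fidelity (rareState N τ M) (rareState N' τ' M)) atTop
      (𝓝 (Real.exp (-(1 / 2 * N + (1 - 1 / 2) * N') +
        fidelity (intensityOp N τ) (intensityOp N' τ')))) := by
  refine (tendsto_vacuum_pow N N' (1 / 2) _).congr' ?_
  filter_upwards [eventually_div_lt_one N, eventually_div_lt_one N'] with M ⟨hM, h1⟩ ⟨_, h1'⟩
  rw [rareState, rareState, fidelity_tensorPow (posSemidef_modeState (by positivity) h1.le hτ.1)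
    (posSemidef_modeState (by positivity) h1'.le hτ'.1),
    fidelity_modeState (by positivity) (by positivity) h1.le hτ.1 hτ'.1,
    smul_div_eq_smul_intensityOp N τ, smul_div_eq_smul_intensityOp N' τ',
    fidelity_smul (hτ.posSemidef_intensityOp hN) (hτ'.posSemidef_intensityOp hN') (by positivity),
    Real.sqrt_eq_rpow, Real.sqrt_eq_rpow]
  norm_num

lemma qRelEntropy_eq_of_supp_le {A B : Matrix d d ℂ} (h : supp A ≤ supp B) :
    qRelEntropy A B =
      ((B.trace.re - A.trace.re + (A * (mlog A - mlog B)).trace.re : ℝ) : EReal) := by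
  rw [qRelEntropy, if_pos h]

/-- On supports that are contained, the relative entropy of the `M`-mode states is computed from the
derivative at `s = 1` of their Chernoff quantity, an `M`-th power; otherwise `C_1 < 1` for the
states, and both sides are infinite. -/
theorem tendsto_qRelEntropy_rareState (hN : 0 ≤ N) (hN' : 0 ≤ N') (hτ : IsDensity τ)
    (hτ' : IsDensity τ') :
    Tendsto (fun M : ℕ => qRelEntropy (rareState N τ M) (rareState N' τ' M)) atTop
      (𝓝 (qRelEntropy (intensityOp N τ) (intensityOp N' τ'))) := by
  have hΓ := hτ.posSemidef_intensityOp hN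
  have hΓ' := hτ'.posSemidef_intensityOp hN'
  have htr := hτ.trace_intensityOp N
  have htr' := hτ'.trace_intensityOp N'
  set Γ := intensityOp N τ
  set Γ' := intensityOp N' τ'
  have hpos : ∀ᶠ M : ℕ in atTop, (rareState N τ M).PosSemidef ∧ (rareState N' τ' M).PosSemidef := by
    filter_upwards [eventually_div_lt_one N, eventually_div_lt_one N'] with M ⟨hM, h1⟩ ⟨_, h1'⟩
    exact ⟨posSemidef_tensorPow (posSemidef_modeState (by positivity) h1.le hτ.1) M,
      posSemidef_tensorPow (posSemidef_modeState (by positivity) h1'.le hτ'.1) M⟩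
  have htrace : ∀ (N : ℝ) {τ : Matrix d d ℂ}, IsDensity τ → ∀ M, (rareState N τ M).trace = 1 := by
    intro N τ hτ M
    rw [rareState, trace_tensorPow, trace_modeState _ hτ.2, one_pow]
  by_cases h : qChernoff 1 Γ Γ' = Γ.trace.re
  · have hsupp := (supp_le_supp_iff hΓ hΓ').mpr h
    have hder := hasDerivAt_qChernoff hΓ hΓ' h
    rw [qRelEntropy_eq_of_supp_le hsupp]
    set L := (Γ * (mlog Γ - mlog Γ')).trace.re
    have hd : HasDerivAt (fun x : ℝ => (1 - N * x) * (Real.log (1 - N * x) -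
        Real.log (1 - N' * x)) + x * L) (N' - N + L) 0 := by
      have h1 := hasDerivAt_one_sub_mul N
      have h2 := hasDerivAt_one_sub_mul N'
      refine ((h1.mul ((h1.log (by simp)).sub (h2.log (by simp)))).add
        ((hasDerivAt_id 0).mul_const L)).congr_deriv ?_
      simp; ring
    have hlim := tendsto_nat_mul_sub_of_hasDerivAt hd
    rw [htr, htr', Complex.ofReal_re, Complex.ofReal_re]
    refine (continuous_coe_real_ereal.continuousAt.tendsto.comp hlim).congr' ?_
    filter_upwards [eventually_qChernoff_rareState hN hN' hτ hτ', hpos,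
      eventually_div_lt_one N, eventually_div_lt_one N'] with M hC ⟨hρ, hρ'⟩ ⟨hM, h1⟩ ⟨_, h1'⟩
    have hM0 : (M : ℝ) ≠ 0 := by positivity
    have hx1 : (1 - N / M) ^ (1 : ℝ) * (1 - N' / M) ^ (1 - 1 : ℝ) +
        1 / M * qChernoff 1 Γ Γ' = 1 := by
      rw [h, htr]; simp; field_simp; ring
    have hρ1 : qChernoff 1 (rareState N τ M) (rareState N' τ' M) = (rareState N τ M).trace.re := by
      rw [hC, hx1, htrace N hτ]; simp
    have hd1 := hasDerivAt_qChernoff hρ hρ' hρ1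
    have hd2 : HasDerivAt (fun s => qChernoff s (rareState N τ M) (rareState N' τ' M))
        (M * ((1 - N / M) * (Real.log (1 - N / M) - Real.log (1 - N' / M)) + 1 / M * L)) 1 := by
      simp only [hC]
      have hb := hasDerivAt_suppPow_mul (1 - N / M) (1 - N' / M) 1 (by linarith) (by linarith)
      simp only [suppPow_of_pos _ (sub_pos.mpr h1), suppPow_of_pos _ (sub_pos.mpr h1')] at hb
      refine ((hb.add (hder.const_mul (1 / (M : ℝ)))).fun_pow M).congr_deriv ?_
      simp only [Pi.add_apply]
      rw [hx1]
      simp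
    rw [qRelEntropy_eq_of_supp_le ((supp_le_supp_iff hρ hρ').mpr hρ1), hd1.unique hd2,
      htrace N hτ, htrace N' hτ']
    simp [div_eq_mul_inv]
  · have hsupp := (supp_le_supp_iff hΓ hΓ').not.mpr h
    have hlt : qChernoff 1 Γ Γ' < N := by
      have := lt_of_le_of_ne (qChernoff_one_le hΓ hΓ') h
      rwa [htr, Complex.ofReal_re] at this
    have h0 := qChernoff_nonneg hΓ hΓ' 1
    rw [qRelEntropy, if_neg hsupp]
    refine tendsto_const_nhds.congr' ?_
    filter_upwards [eventually_qChernoff_rareState hN hN' hτ hτ', hpos,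
      eventually_div_lt_one N] with M hC ⟨hρ, hρ'⟩ ⟨hM, h1⟩
    have hM0 : (0 : ℝ) < M := by positivity
    rw [qRelEntropy, if_neg]
    rw [supp_le_supp_iff hρ hρ', hC, htrace N hτ, Complex.one_re]
    refine (pow_lt_one₀ ?_ ?_ hM.ne').ne
    · have : 0 ≤ 1 - N / M := by linarith
      simp only [sub_self, Real.rpow_one, Real.rpow_zero, mul_one]
      positivity
    · simp only [sub_self, Real.rpow_one, Real.rpow_zero, mul_one]
      have : 1 / (M : ℝ) * qChernoff 1 Γ Γ' < 1 / M * N := by gcongr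
      linarith [show 1 / (M : ℝ) * N = N / M by ring]

end

/-! ### Monotonicity under a measurement -/

section

open MeasureTheory

/-- A geometric mean with weight `s ∈ (0, 1)` is an integral of parallel sums. -/
lemma exists_measure_rpow_mul_rpow_eq_lintegral {s : ℝ} (hs : s ∈ Set.Ioo (0 : ℝ) 1) :
    ∃ μ : Measure ℝ, ∀ p q : ℝ, 0 ≤ p → 0 ≤ q → ENNReal.ofReal (suppPow s p * suppPow (1 - s) q) =
      ∫⁻ t in Set.Ioi 0, ENNReal.ofReal (t ^ (s - 2) * parSum p (t * q)) ∂μ := by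
  obtain ⟨μ, hμ⟩ := Real.exists_measure_rpow_eq_integral_rpowIntegrand₀₁ hs
  refine ⟨μ, fun p q hp hq => ?_⟩
  rcases hq.eq_or_lt with rfl | hq
  · simp [parSum]
  obtain ⟨hint, heq⟩ := hμ (p / q) (div_nonneg hp hq.le)
  have h1 : suppPow s p * suppPow (1 - s) q = q * (p / q) ^ s := by
    rw [suppPow_of_ne hs.1.ne', suppPow_of_pos _ hq, Real.div_rpow hp hq.le, Real.rpow_sub hq,
      Real.rpow_one]
    ring
  rw [h1, heq, ← integral_const_mul, ofReal_integral_eq_lintegral_ofReal (hint.const_mul q)]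
  · refine setLIntegral_congr_fun measurableSet_Ioi fun t (ht : 0 < t) => ?_
    congr 1
    rw [Real.rpowIntegrand₀₁_eq_pow_div hs ht.le (div_nonneg hp hq.le), parSum,
      show s - 1 = s - 2 + 1 by ring, Real.rpow_add_one ht.ne']
    have : 0 < p + t * q := by positivity
    have : 0 < t + p / q := by positivity
    have : 0 < t * q + p := by positivity
    field_simp
    ring
  · refine (ae_restrict_iff' measurableSet_Ioi).mpr (ae_of_all _ fun t (ht : 0 < t) => ?_)
    exact mul_nonneg hq.le (Real.rpowIntegrand₀₁_nonneg hs.1 ht.le (div_nonneg hp hq.le))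

lemma measurable_ofReal_rpow_mul_parSum (s p q : ℝ) :
    Measurable fun t : ℝ => ENNReal.ofReal (t ^ (s - 2) * parSum p (t * q)) := by
  unfold parSum
  fun_prop

variable {d J : Type*} [Fintype d] [DecidableEq d]

lemma trace_mul_re_nonneg {A B : Matrix d d ℂ} (hA : A.PosSemidef) (hB : B.PosSemidef) :
    0 ≤ (A * B).trace.re := by
  have h := (hA.mul_mul_conjTranspose_same (msqrt B)).trace_nonneg
  rw [(posSemidef_msqrt hB).1.eq, trace_mul_comm, ← Matrix.mul_assoc, msqrt_mul_self hB,
    trace_mul_comm] at h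
  exact (Complex.nonneg_iff.mp h).1

omit [DecidableEq d] in
lemma HasSum.trace_mul_re {f : J → Matrix d d ℂ} {X : Matrix d d ℂ} (hf : HasSum f X)
    (A : Matrix d d ℂ) : HasSum (fun j => (f j * A).trace.re) (X * A).trace.re := by
  let φ : Matrix d d ℂ →+ ℝ :=
    (Complex.reAddGroupHom.comp (traceAddMonoidHom d ℂ)).comp (AddMonoidHom.mulRight A)
  have hφ : Continuous φ :=
    Complex.continuous_re.comp ((continuous_id.matrix_mul continuous_const).matrix_trace)
  exact hf.map φ hφ

section POVM

variable {E : J → Matrix d d ℂ} (hE : IsPOVM E)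
include hE

lemma IsPOVM.intensity_nonneg {A : Matrix d d ℂ} (hA : A.PosSemidef) (j : J) :
    0 ≤ intensity E A j :=
  trace_mul_re_nonneg (hE.posSemidef j) hA

lemma IsPOVM.hasSum_intensity (A : Matrix d d ℂ) : HasSum (intensity E A) A.trace.re := by
  have h := hE.hasSum_one.trace_mul_re A
  rw [Matrix.one_mul] at h
  exact h

lemma IsPOVM.summable_smul {x : J → ℝ} (hx0 : ∀ j, 0 ≤ x j) (hx1 : ∀ j, x j ≤ 1) :
    Summable fun j => (x j : ℂ) • E j := by
  have h := hE.hasSum_one.summable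
  refine Pi.summable.mpr fun a => Pi.summable.mpr fun b => ?_
  have hab := (Pi.summable.mp (Pi.summable.mp h a) b).norm
  refine Summable.of_norm_bounded hab fun j => ?_
  change ‖(x j : ℂ) * E j a b‖ ≤ ‖E j a b‖
  rw [norm_mul, Complex.norm_real, Real.norm_of_nonneg (hx0 j)]
  exact mul_le_of_le_one_left (norm_nonneg _) (hx1 j)

/-- Kadison's inequality `X² ≤ ∑ (x j)² E j` for `X = ∑ x j E j`, tested against `A ≥ 0`: the
difference of the two sides is `∑ (x j - X) E j (x j - X)`. -/
lemma IsPOVM.trace_sq_mul_le {x : J → ℝ} (hx0 : ∀ j, 0 ≤ x j) (hx1 : ∀ j, x j ≤ 1)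
    {X : Matrix d d ℂ} (hX : HasSum (fun j => (x j : ℂ) • E j) X) {A : Matrix d d ℂ}
    (hA : A.PosSemidef) :
    (X * X * A).trace.re ≤ ∑' j, x j ^ 2 * intensity E A j := by
  have hXh : Xᴴ = X := by
    refine HasSum.unique ?_ hX
    convert hX.matrix_conjTranspose using 2 with j
    rw [conjTranspose_smul, (hE.posSemidef j).1.eq]; simp
  obtain ⟨Z, hZ⟩ := hE.summable_smul (x := fun j => x j ^ 2) (fun j => by positivity)
    (fun j => pow_le_one₀ (hx0 j) (hx1 j))
  have hZA := hZ.trace_mul_re A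
  have e : ∀ j, ((((x j ^ 2 : ℝ) : ℂ) • E j) * A).trace.re = x j ^ 2 * intensity E A j := by
    intro j
    rw [Matrix.smul_mul, trace_smul, smul_eq_mul, Complex.re_ofReal_mul, intensity]
  simp only [e] at hZA
  have hsum : HasSum (fun j => ((x j : ℂ) • 1 - X) * E j * ((x j : ℂ) • 1 - X)) (Z - X * X) := by
    have h1 := ((hZ.sub (hX.mul_right X)).sub (hX.mul_left X)).add
      ((hE.hasSum_one.mul_left X).mul_right X)
    rw [Matrix.mul_one, sub_add_cancel] at h1
    have e : ∀ j, ((x j : ℂ) • 1 - X) * E j * ((x j : ℂ) • 1 - X) = ((x j ^ 2 : ℝ) : ℂ) • E j -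
        (x j : ℂ) • E j * X - X * (x j : ℂ) • E j + X * E j * X := by
      intro j
      rw [Complex.ofReal_pow]
      simp only [sub_mul, mul_sub, Matrix.smul_mul, Matrix.mul_smul, Matrix.one_mul, Matrix.mul_one,
        smul_smul, pow_two]
      abel
    simp only [e]
    exact h1
  have hnn := (hsum.trace_mul_re A).nonneg fun j => trace_mul_re_nonneg (by
    have := (hE.posSemidef j).mul_mul_conjTranspose_same ((x j : ℂ) • 1 - X)
    have h2 : ((x j : ℂ) • 1 - X)ᴴ = (x j : ℂ) • 1 - X := by
      rw [conjTranspose_sub, hXh, conjTranspose_smul]; simp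
    rwa [h2] at this) hA
  rw [hZA.tsum_eq]
  rw [sub_mul, trace_sub, Complex.sub_re] at hnn
  linarith

lemma IsPOVM.summable_parSum {A B : Matrix d d ℂ} (hA : A.PosSemidef) (hB : B.PosSemidef)
    {t : ℝ} (ht : 0 ≤ t) : Summable fun j => parSum (intensity E A j) (t * intensity E B j) :=
  Summable.of_nonneg_of_le
    (fun j => parSum_nonneg (hE.intensity_nonneg hA j) (mul_nonneg ht (hE.intensity_nonneg hB j)))
    (fun j => parSum_le_left (hE.intensity_nonneg hA j) (mul_nonneg ht (hE.intensity_nonneg hB j)))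
    (hE.hasSum_intensity A).summable

/-- Some Hermitian `X` brings the quantum variational expression down to the classical sum of
parallel sums. -/
lemma IsPOVM.exists_trace_add_le {A B : Matrix d d ℂ} (hA : A.PosSemidef) (hB : B.PosSemidef)
    {t : ℝ} (ht : 0 ≤ t) :
    ∃ X : Matrix d d ℂ, X.IsHermitian ∧
      (X * X * A).trace.re + t * ((1 - X) * (1 - X) * B).trace.re ≤
      ∑' j, parSum (intensity E A j) (t * intensity E B j) := by
  have hΛ := hE.intensity_nonneg hA
  have hΛ' : ∀ j, 0 ≤ t * intensity E B j := fun j => mul_nonneg ht (hE.intensity_nonneg hB j)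
  -- `x j` attains the minimum defining the parallel sum of `tr E j A` and `t tr E j B`
  set x : J → ℝ := fun j => t * intensity E B j / (intensity E A j + t * intensity E B j) with hx
  have hx0 : ∀ j, 0 ≤ x j := fun j => div_nonneg (hΛ' j) (add_nonneg (hΛ j) (hΛ' j))
  have hx1 : ∀ j, x j ≤ 1 := fun j =>
    div_le_one_of_le₀ (by linarith [hΛ j]) (add_nonneg (hΛ j) (hΛ' j))
  obtain ⟨X, hX⟩ := hE.summable_smul hx0 hx1
  have hX' : HasSum (fun j => ((1 - x j : ℝ) : ℂ) • E j) (1 - X) := by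
    have e : ∀ j, ((1 - x j : ℝ) : ℂ) • E j = E j - (x j : ℂ) • E j := fun j => by
      rw [Complex.ofReal_sub, sub_smul, Complex.ofReal_one, one_smul]
    simp only [e]
    exact hE.hasSum_one.sub hX
  have hXh : X.IsHermitian := by
    refine HasSum.unique ?_ hX
    convert hX.matrix_conjTranspose using 2 with j
    rw [conjTranspose_smul, (hE.posSemidef j).1.eq]; simp
  refine ⟨X, hXh, ?_⟩
  have h1 := hE.trace_sq_mul_le hx0 hx1 hX hA
  have h2 := hE.trace_sq_mul_le (fun j => by linarith [hx1 j]) (fun j => by linarith [hx0 j]) hX' hB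
  have hs1 : Summable fun j => x j ^ 2 * intensity E A j :=
    Summable.of_nonneg_of_le (fun j => mul_nonneg (sq_nonneg _) (hΛ j))
      (fun j => mul_le_of_le_one_left (hΛ j) (pow_le_one₀ (hx0 j) (hx1 j)))
      (hE.hasSum_intensity A).summable
  have hs2 : Summable fun j => (1 - x j) ^ 2 * intensity E B j :=
    Summable.of_nonneg_of_le (fun j => mul_nonneg (sq_nonneg _) (hE.intensity_nonneg hB j))
      (fun j => mul_le_of_le_one_left (hE.intensity_nonneg hB j)
        (pow_le_one₀ (by linarith [hx1 j]) (by linarith [hx0 j])))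
      (hE.hasSum_intensity B).summable
  calc _ ≤ ∑' j, x j ^ 2 * intensity E A j + t * ∑' j, (1 - x j) ^ 2 * intensity E B j := by gcongr
    _ = ∑' j, parSum (intensity E A j) (t * intensity E B j) := by
      rw [← tsum_mul_left, ← hs1.tsum_add (hs2.mul_left t)]
      refine tsum_congr fun j => ?_
      rw [parSum_eq (hΛ j) (hΛ' j)]
      ring

omit hE in
lemma summable_chernoff {ι : Type*} {p q : ι → ℝ} {s : ℝ} (hs : s ∈ Set.Icc (0 : ℝ) 1)
    (hp : ∀ i, 0 ≤ p i) (hq : ∀ i, 0 ≤ q i) (hps : Summable p) (hqs : Summable q) :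
    Summable fun i => suppPow s (p i) * suppPow (1 - s) (q i) :=
  Summable.of_nonneg_of_le (fun i => mul_nonneg (suppPow_nonneg _ (hp i)) (suppPow_nonneg _ (hq i)))
    (fun i => suppPow_mul_suppPow_le hs.1 hs.2 (hp i) (hq i))
    ((hps.mul_left s).add (hqs.mul_left (1 - s)))

omit hE in
/-- Continuity of the classical Chernoff quantity from within `(0, 1)`, endpoints included; the
family `p + q` dominates. -/
lemma tendsto_chernoff {ι : Type*} {p q : ι → ℝ} (s₀ : ℝ)
    (hp : ∀ i, 0 ≤ p i) (hq : ∀ i, 0 ≤ q i) (hps : Summable p) (hqs : Summable q) :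
    Tendsto (fun s => chernoff s p q) (𝓝[Set.Ioo 0 1] s₀) (𝓝 (chernoff s₀ p q)) := by
  refine tendsto_tsum_of_dominated_convergence (hps.add hqs) (fun i => ?_) ?_
  · exact (hasDerivAt_suppPow_mul _ _ s₀ (hp i) (hq i)).continuousAt.tendsto.mono_left
      nhdsWithin_le_nhds
  · filter_upwards [self_mem_nhdsWithin] with s hs i
    rw [Real.norm_of_nonneg (mul_nonneg (suppPow_nonneg _ (hp i)) (suppPow_nonneg _ (hq i)))]
    refine (suppPow_mul_suppPow_le hs.1.le hs.2.le (hp i) (hq i)).trans ?_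
    have := mul_le_of_le_one_left (hp i) hs.2.le
    have := mul_le_of_le_one_left (hq i) (show 1 - s ≤ 1 by linarith [hs.1])
    linarith

/-- The quantum Chernoff quantity is at most that of the outcome intensities. -/
theorem IsPOVM.qChernoff_le_chernoff [Countable J] {A B : Matrix d d ℂ} (hA : A.PosSemidef)
    (hB : B.PosSemidef) {s : ℝ} (hs : s ∈ Set.Icc (0 : ℝ) 1) :
    qChernoff s A B ≤ chernoff s (intensity E A) (intensity E B) := by
  have hΛ := hE.intensity_nonneg hA
  have hΛ' := hE.intensity_nonneg hB
  have hS := (hE.hasSum_intensity A).summable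
  have hS' := (hE.hasSum_intensity B).summable
  have main : ∀ s ∈ Set.Ioo (0 : ℝ) 1,
      qChernoff s A B ≤ chernoff s (intensity E A) (intensity E B) := by
    intro s hs
    obtain ⟨a, b, c, ha, hb, hc, hC, -, -, hvar⟩ := exists_qChernoff_eq hA hB
    -- both sides are integrals of parallel sums, which are compared for each `t`
    obtain ⟨μ, hμ⟩ := exists_measure_rpow_mul_rpow_eq_lintegral hs
    have hnn : ∀ j, 0 ≤ suppPow s (intensity E A j) * suppPow (1 - s) (intensity E B j) :=
      fun j => mul_nonneg (suppPow_nonneg _ (hΛ j)) (suppPow_nonneg _ (hΛ' j))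
    rw [chernoff, ← ENNReal.ofReal_le_ofReal_iff (tsum_nonneg hnn),
      ENNReal.ofReal_tsum_of_nonneg hnn (summable_chernoff ⟨hs.1.le, hs.2.le⟩ hΛ hΛ' hS hS')]
    have hL : ENNReal.ofReal (qChernoff s A B) = ∫⁻ t in Set.Ioi 0, ∑ i, ∑ j,
        ENNReal.ofReal (t ^ (s - 2) * parSum (a i) (t * b j)) * ENNReal.ofReal (c i j) ∂μ := by
      have hm := measurable_ofReal_rpow_mul_parSum s
      rw [lintegral_finsetSum _ fun i _ => Finset.measurable_sum _ fun j _ => (hm _ _).mul_const _,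
        hC, ENNReal.ofReal_sum_of_nonneg fun i _ => Finset.sum_nonneg fun j _ =>
          mul_nonneg (mul_nonneg (suppPow_nonneg _ (ha i)) (suppPow_nonneg _ (hb j))) (hc i j)]
      refine Finset.sum_congr rfl fun i _ => ?_
      rw [lintegral_finsetSum _ fun j _ => (hm _ _).mul_const _,
        ENNReal.ofReal_sum_of_nonneg fun j _ =>
          mul_nonneg (mul_nonneg (suppPow_nonneg _ (ha i)) (suppPow_nonneg _ (hb j))) (hc i j)]
      refine Finset.sum_congr rfl fun j _ => ?_
      rw [lintegral_mul_const _ (hm _ _), ← hμ _ _ (ha i) (hb j), ENNReal.ofReal_mul' (hc i j)]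
    have hR : ∑' j, ENNReal.ofReal (suppPow s (intensity E A j) * suppPow (1 - s) (intensity E B j))
        = ∫⁻ t in Set.Ioi 0, ∑' j, ENNReal.ofReal (t ^ (s - 2) *
          parSum (intensity E A j) (t * intensity E B j)) ∂μ := by
      rw [lintegral_tsum fun j => (measurable_ofReal_rpow_mul_parSum _ _ _).aemeasurable]
      exact tsum_congr fun j => hμ _ _ (hΛ j) (hΛ' j)
    rw [hL, hR]
    refine setLIntegral_mono' measurableSet_Ioi fun t (ht : 0 < t) => ?_
    obtain ⟨X, hX, hXle⟩ := hE.exists_trace_add_le hA hB ht.le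
    have hw : 0 ≤ t ^ (s - 2) := Real.rpow_nonneg ht.le _
    have hpa : ∀ i j, 0 ≤ parSum (a i) (t * b j) := fun i j =>
      parSum_nonneg (ha i) (mul_nonneg ht.le (hb j))
    have hpΛ : ∀ j, 0 ≤ parSum (intensity E A j) (t * intensity E B j) := fun j =>
      parSum_nonneg (hΛ j) (mul_nonneg ht.le (hΛ' j))
    rw [← ENNReal.ofReal_tsum_of_nonneg (fun j => mul_nonneg hw (hpΛ j))
      ((hE.summable_parSum hA hB ht.le).mul_left _), tsum_mul_left]
    calc _ = ENNReal.ofReal (t ^ (s - 2) * ∑ i, ∑ j, parSum (a i) (t * b j) * c i j) := by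
          rw [Finset.mul_sum, ENNReal.ofReal_sum_of_nonneg fun i _ => mul_nonneg hw
            (Finset.sum_nonneg fun j _ => mul_nonneg (hpa i j) (hc i j))]
          refine Finset.sum_congr rfl fun i _ => ?_
          rw [Finset.mul_sum, ENNReal.ofReal_sum_of_nonneg fun j _ => mul_nonneg hw
            (mul_nonneg (hpa i j) (hc i j))]
          refine Finset.sum_congr rfl fun j _ => ?_
          rw [← mul_assoc, ENNReal.ofReal_mul' (hc i j)]
      _ ≤ _ := ENNReal.ofReal_le_ofReal
          (mul_le_mul_of_nonneg_left ((hvar t ht.le X hX).trans hXle) hw)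
  -- both sides are continuous from within `(0, 1)`, which covers `s = 0` and `s = 1`
  have : (𝓝[Set.Ioo (0 : ℝ) 1] s).NeBot := by
    rw [← mem_closure_iff_nhdsWithin_neBot, closure_Ioo zero_ne_one]
    exact hs
  refine le_of_tendsto_of_tendsto
    ((continuous_qChernoff hA hB).continuousAt.tendsto.mono_left nhdsWithin_le_nhds)
    (tendsto_chernoff s hΛ hΛ' hS hS') ?_
  filter_upwards [self_mem_nhdsWithin] with s hs using main s hs

omit hE [DecidableEq d] in
/-- Cauchy–Schwarz for the Hilbert–Schmidt inner product. -/
lemma trace_mul_re_le_sqrt_mul_sqrt (Y Z : Matrix d d ℂ) :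
    (Y * Z).trace.re ≤ √(Y * Yᴴ).trace.re * √(Zᴴ * Z).trace.re := by
  have h1 : (Y * Yᴴ).trace.re = ∑ p : d × d, ‖Y p.1 p.2‖ ^ 2 := by
    rw [Fintype.sum_prod_type, trace, Complex.re_sum]
    refine Finset.sum_congr rfl fun i _ => ?_
    rw [diag_apply, mul_apply, Complex.re_sum]
    refine Finset.sum_congr rfl fun j _ => ?_
    rw [conjTranspose_apply, ← Complex.normSq_eq_norm_sq, Complex.star_def, Complex.mul_conj,
      Complex.ofReal_re]
  have h2 : (Zᴴ * Z).trace.re = ∑ p : d × d, ‖Z p.2 p.1‖ ^ 2 := by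
    rw [Fintype.sum_prod_type, trace, Complex.re_sum]
    refine Finset.sum_congr rfl fun i _ => ?_
    rw [diag_apply, mul_apply, Complex.re_sum]
    refine Finset.sum_congr rfl fun j _ => ?_
    rw [conjTranspose_apply, ← Complex.normSq_eq_norm_sq, mul_comm, Complex.star_def,
      Complex.mul_conj, Complex.ofReal_re]
  rw [h1, h2]
  refine le_trans ?_ (Real.sum_mul_le_sqrt_mul_sqrt _ _ _)
  rw [Fintype.sum_prod_type, trace, Complex.re_sum]
  refine Finset.sum_le_sum fun i _ => ?_
  rw [diag_apply, mul_apply, Complex.re_sum]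
  refine Finset.sum_le_sum fun j _ => ?_
  rw [← norm_mul]
  exact Complex.re_le_norm _

/-- The Fuchs–Caves bound: the fidelity is at most the classical one of the outcome
intensities. -/
theorem IsPOVM.fidelity_le_chernoff {A B : Matrix d d ℂ} (hA : A.PosSemidef)
    (hB : B.PosSemidef) :
    fidelity A B ≤ chernoff (1 / 2) (intensity E A) (intensity E B) := by
  have hΛ := hE.intensity_nonneg hA
  have hΛ' := hE.intensity_nonneg hB
  have hS := (hE.hasSum_intensity A).summable
  have hS' := (hE.hasSum_intensity B).summable
  have hAs := (posSemidef_msqrt hA).1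
  have hBs := (posSemidef_msqrt hB).1
  set K := msqrt A * B * msqrt A with hK
  have hKp : K.PosSemidef := posSemidef_msqrt_mul_mul_msqrt hA hB
  -- `W = |√B √A|⁺ (√B √A)ᴴ` is a contraction with `|√B √A| = W √B √A`
  set R := cfc (fun x : ℝ => (√x)⁻¹) K with hR
  have hRh : Rᴴ = R := isHermitian_cfc _ _
  set W := R * msqrt A * msqrt B with hW
  have hpolar : msqrt K = W * msqrt B * msqrt A := by
    have : W * msqrt B * msqrt A = R * K := by
      rw [hW, hK, ← msqrt_mul_self hB]
      simp only [Matrix.mul_assoc, msqrt_mul_self hB]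
    rw [this]
    have hcomm : R * K = cfc (fun x : ℝ => (√x)⁻¹ * x) K := by
      conv_lhs => enter [2]; rw [← cfc_id' ℝ K hKp.1.isSelfAdjoint]
      rw [hR, cfc_mul_cfc]
    rw [hcomm, msqrt]
    refine cfc_congr fun x hx => ?_
    rw [inv_mul_eq_div, Real.div_sqrt]
  have hcontr : (1 - W * Wᴴ).PosSemidef := by
    have e : W * Wᴴ = cfc (fun x : ℝ => (√x)⁻¹ * x * (√x)⁻¹) K := by
      rw [← cfc_mul_cfc, ← cfc_mul_cfc (fun x : ℝ => (√x)⁻¹) (fun x => x),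
        cfc_id' ℝ K hKp.1.isSelfAdjoint, ← hR, hW, hK, conjTranspose_mul, conjTranspose_mul, hRh,
        hAs.eq, hBs.eq]
      conv_rhs => rw [← msqrt_mul_self hB]
      simp only [Matrix.mul_assoc]
    have e1 : (1 : Matrix d d ℂ) = cfc (fun _ : ℝ => (1 : ℝ)) K :=
      (cfc_one ℝ K hKp.1.isSelfAdjoint).symm
    rw [e, e1, ← cfc_sub _ _ K (continuousOn_spectrum _ _) (continuousOn_spectrum _ _)]
    refine posSemidef_cfc hKp fun x hx => ?_
    rcases hx.eq_or_lt with rfl | hx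
    · simp
    · have : √x ≠ 0 := (Real.sqrt_pos.mpr hx).ne'
      have h2 : (√x)⁻¹ * x * (√x)⁻¹ = 1 := by
        nth_rewrite 2 [← Real.mul_self_sqrt hx.le]
        field_simp
      rw [h2, sub_self]
  have hsum : HasSum (fun j => (E j * (msqrt A * (W * msqrt B))).trace.re) (fidelity A B) := by
    have := hE.hasSum_one.trace_mul_re (msqrt A * (W * msqrt B))
    rwa [Matrix.one_mul, trace_mul_comm, ← hpolar] at this
  have hC := (summable_chernoff (s := 1 / 2) ⟨by norm_num, by norm_num⟩ hΛ hΛ' hS hS').hasSum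
  refine hasSum_le (fun j => ?_) hsum hC
  have hEj := hE.posSemidef j
  have hEs := (posSemidef_msqrt hEj).1
  set G := msqrt (E j)
  have hGG : G * G = E j := msqrt_mul_self hEj
  have e1 : (E j * (msqrt A * (W * msqrt B))).trace =
      ((G * msqrt A * W) * (msqrt B * G)).trace := by
    rw [← hGG, Matrix.mul_assoc, trace_mul_comm]
    simp only [Matrix.mul_assoc]
  have e2 : ((msqrt B * G)ᴴ * (msqrt B * G)).trace.re = intensity E B j := by
    rw [conjTranspose_mul, hEs.eq, hBs.eq, trace_mul_comm, intensity, ← hGG]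
    rw [show msqrt B * G * (G * msqrt B) = msqrt B * (G * G * msqrt B) by
      simp only [Matrix.mul_assoc], trace_mul_comm, Matrix.mul_assoc, msqrt_mul_self hB]
  have e3 : ((G * msqrt A * W) * (G * msqrt A * W)ᴴ).trace.re ≤ intensity E A j := by
    have h := trace_mul_re_nonneg hcontr
      (posSemidef_conjTranspose_mul_self (G * msqrt A))
    have h1 : (W * Wᴴ * ((G * msqrt A)ᴴ * (G * msqrt A))).trace =
        ((G * msqrt A * W) * (G * msqrt A * W)ᴴ).trace := by
      rw [trace_mul_comm, conjTranspose_mul (G * msqrt A)]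
      rw [show (G * msqrt A)ᴴ * (G * msqrt A) * (W * Wᴴ) =
        (G * msqrt A)ᴴ * ((G * msqrt A) * (W * Wᴴ)) by simp only [Matrix.mul_assoc], trace_mul_comm]
      simp only [Matrix.mul_assoc]
    have h2 : ((G * msqrt A)ᴴ * (G * msqrt A)).trace.re = intensity E A j := by
      rw [conjTranspose_mul, hEs.eq, hAs.eq, intensity, ← hGG,
        show msqrt A * G * (G * msqrt A) = msqrt A * (G * G * msqrt A) by
        simp only [Matrix.mul_assoc], trace_mul_comm, Matrix.mul_assoc, msqrt_mul_self hA]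
    rw [sub_mul, trace_sub, Complex.sub_re, Matrix.one_mul, h1, h2] at h
    linarith
  rw [e1, suppPow_of_ne (by norm_num), suppPow_of_ne (by norm_num)]
  refine (trace_mul_re_le_sqrt_mul_sqrt _ _).trans ?_
  rw [e2, show (1 : ℝ) - 1 / 2 = 1 / 2 by norm_num, ← Real.sqrt_eq_rpow, ← Real.sqrt_eq_rpow]
  exact mul_le_mul_of_nonneg_right (Real.sqrt_le_sqrt e3) (Real.sqrt_nonneg _)

end POVM

end

/-! ### Poisson counting distributions -/

/-- The sum over a box of finitely supported count vectors is a product of one-variable sums. -/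
lemma sum_finsupp_prod {J : Type*} {g : J → ℕ → ℝ} (hg : ∀ j, g j 0 = 1) (S : Finset J)
    (t : J → Finset ℕ) :
    ∑ m ∈ S.finsupp t, m.prod g = ∏ j ∈ S, ∑ k ∈ t j, g j k := by
  classical
  rw [Finset.prod_sum, Finset.finsupp, Finset.sum_map]
  refine Finset.sum_congr rfl fun p _ => ?_
  change (Finsupp.indicator S p).prod g = _
  rw [Finsupp.prod_of_support_subset (s := S) _ (Finsupp.support_indicator_subset S p) _
    fun j _ => hg j, ← Finset.prod_attach]
  refine Finset.prod_congr rfl fun j _ => ?_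
  simp

/-- The exponential series in arbitrarily many variables:
`∑ m, ∏ j, a j ^ m j / (m j)! = exp (∑ j, a j)`. Sums over boxes of count vectors factor, and the
boxes exhaust the finitely supported vectors. -/
theorem hasSum_finsupp_prod_pow_div_factorial {J : Type*} {a : J → ℝ} {A : ℝ} (ha : ∀ j, 0 ≤ a j)
    (hA : HasSum a A) :
    HasSum (fun m : J →₀ ℕ => m.prod fun j k => a j ^ k / (k.factorial : ℝ)) (Real.exp A) := by
  classical
  set g : J → ℕ → ℝ := fun j k => a j ^ k / (k.factorial : ℝ) with hg
  have hg0 : ∀ j, g j 0 = 1 := fun j => by simp [hg]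
  have hgn : ∀ j k, 0 ≤ g j k := fun j k => div_nonneg (pow_nonneg (ha j) k) (Nat.cast_nonneg _)
  have hgs : ∀ j, HasSum (g j) (Real.exp (a j)) := fun j => by
    rw [Real.exp_eq_exp_ℝ]; exact NormedSpace.expSeries_div_hasSum_exp (a j)
  refine hasSum_of_isLUB_of_nonneg _ (fun m => Finset.prod_nonneg fun j _ => hgn j _) ⟨?_, ?_⟩
  · rintro _ ⟨T, rfl⟩
    -- a finite set of count vectors lies in a box
    obtain ⟨n, hn⟩ : ∃ n, ∀ m ∈ T, ∀ j, m j < n := by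
      refine ⟨(T.sup fun m => m.support.sup m) + 1, fun m hm j => Nat.lt_succ_of_le ?_⟩
      by_cases hj : m j = 0
      · simp [hj]
      · exact (Finset.le_sup (f := m) (Finsupp.mem_support_iff.mpr hj)).trans
          (Finset.le_sup (f := fun m : J →₀ ℕ => m.support.sup m) hm)
    calc ∑ m ∈ T, m.prod g
        ≤ ∑ m ∈ (T.biUnion fun m => m.support).finsupp fun _ => Finset.range n, m.prod g := by
          refine Finset.sum_le_sum_of_subset_of_nonneg (fun m hm => ?_)
            fun m _ _ => Finset.prod_nonneg fun j _ => hgn j _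
          rw [Finset.mem_finsupp_iff]
          exact ⟨Finset.subset_biUnion_of_mem (fun m : J →₀ ℕ => m.support) hm,
            fun j _ => Finset.mem_range.mpr (hn m hm j)⟩
      _ = ∏ j ∈ T.biUnion fun m => m.support, ∑ k ∈ Finset.range n, g j k :=
          sum_finsupp_prod hg0 _ _
      _ ≤ ∏ j ∈ T.biUnion fun m => m.support, Real.exp (a j) := by
          refine Finset.prod_le_prod (fun j _ => Finset.sum_nonneg fun k _ => hgn j k) fun j _ => ?_
          exact sum_le_hasSum _ (fun k _ => hgn j k) (hgs j)
      _ ≤ Real.exp A := by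
          rw [← Real.exp_sum]
          exact Real.exp_le_exp.mpr (sum_le_hasSum _ (fun j _ => ha j) hA)
  · intro c hc
    have h1 : ∀ S : Finset J, Real.exp (∑ j ∈ S, a j) ≤ c := by
      intro S
      rw [Real.exp_sum]
      refine le_of_tendsto (tendsto_finsetProd S fun j _ => (hgs j).tendsto_sum_nat)
        (Eventually.of_forall fun n => ?_)
      rw [← sum_finsupp_prod hg0]
      exact hc ⟨_, rfl⟩
    exact le_of_tendsto (Real.continuous_exp.continuousAt.tendsto.comp hA) (Eventually.of_forall h1)

section Poisson

variable {J : Type*} {Λ Λ' : J → ℝ} {N N' : ℝ}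

/-- The infinite product splits into the convergent product of the normalizations and a finite
product over the support of `m`. -/
lemma poissonDist_eq (hΛs : HasSum Λ N) (m : J →₀ ℕ) :
    poissonDist Λ m = Real.exp (-N) * m.prod fun j k => Λ j ^ k / (k.factorial : ℝ) := by
  have h1 : HasProd (fun j => Real.exp (-Λ j)) (Real.exp (-N)) := hΛs.neg.rexp
  have h2 : HasProd (fun j => Λ j ^ m j / ((m j).factorial : ℝ))
      (m.prod fun j k => Λ j ^ k / (k.factorial : ℝ)) :=
    hasProd_prod_of_ne_finset_one fun j hj => by simp [Finsupp.notMem_support_iff.mp hj]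
  rw [← (h1.mul h2).tprod_eq, poissonDist]
  exact tprod_congr fun j => mul_div_assoc _ _ _

lemma poissonDist_nonneg (hΛ : ∀ j, 0 ≤ Λ j) (hΛs : HasSum Λ N) (m : J →₀ ℕ) :
    0 ≤ poissonDist Λ m := by
  rw [poissonDist_eq hΛs]
  exact mul_nonneg (Real.exp_nonneg _) (Finset.prod_nonneg fun j _ =>
    div_nonneg (pow_nonneg (hΛ j) _) (Nat.cast_nonneg _))

lemma hasSum_poissonDist (hΛ : ∀ j, 0 ≤ Λ j) (hΛs : HasSum Λ N) : HasSum (poissonDist Λ) 1 := by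
  have h := (hasSum_finsupp_prod_pow_div_factorial hΛ hΛs).mul_left (Real.exp (-N))
  rw [← Real.exp_add, neg_add_cancel, Real.exp_zero] at h
  simpa only [← poissonDist_eq hΛs] using h

lemma suppPow_finset_prod {ι : Type*} (s : ℝ) (S : Finset ι) {f : ι → ℝ} (hf : ∀ i, 0 ≤ f i) :
    suppPow s (∏ i ∈ S, f i) = ∏ i ∈ S, suppPow s (f i) := by
  classical
  induction S using Finset.induction_on with
  | empty => simp
  | insert i S hi ih =>
    rw [Finset.prod_insert hi, Finset.prod_insert hi,
      suppPow_mul _ (hf i) (Finset.prod_nonneg fun _ _ => hf _), ih]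

lemma suppPow_pow (s : ℝ) {x : ℝ} (hx : 0 ≤ x) (k : ℕ) : suppPow s (x ^ k) = suppPow s x ^ k := by
  simpa using suppPow_finset_prod s (Finset.range k) (f := fun _ => x) fun _ => hx

lemma suppPow_poissonDist_mul (hΛ : ∀ j, 0 ≤ Λ j) (hΛ' : ∀ j, 0 ≤ Λ' j) (hΛs : HasSum Λ N)
    (hΛs' : HasSum Λ' N') (s : ℝ) (m : J →₀ ℕ) :
    suppPow s (poissonDist Λ m) * suppPow (1 - s) (poissonDist Λ' m) =
      Real.exp (-(s * N + (1 - s) * N')) *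
        m.prod fun j k => (suppPow s (Λ j) * suppPow (1 - s) (Λ' j)) ^ k / (k.factorial : ℝ) := by
  have hf : ∀ {Λ : J → ℝ}, (∀ j, 0 ≤ Λ j) → ∀ j, 0 ≤ Λ j ^ m j / ((m j).factorial : ℝ) :=
    fun h j => div_nonneg (pow_nonneg (h j) _) (Nat.cast_nonneg _)
  have hexp : ∀ s x : ℝ, suppPow s (Real.exp (-x)) = Real.exp (-(s * x)) := fun s x => by
    rw [suppPow_of_pos _ (Real.exp_pos _), ← Real.exp_mul]; ring_nf
  rw [poissonDist_eq hΛs, poissonDist_eq hΛs', Finsupp.prod, Finsupp.prod, Finsupp.prod,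
    suppPow_mul _ (Real.exp_nonneg _) (Finset.prod_nonneg fun j _ => hf hΛ j),
    suppPow_mul _ (Real.exp_nonneg _) (Finset.prod_nonneg fun j _ => hf hΛ' j),
    suppPow_finset_prod _ _ (hf hΛ), suppPow_finset_prod _ _ (hf hΛ'), hexp, hexp,
    mul_mul_mul_comm, ← Real.exp_add, ← Finset.prod_mul_distrib]
  congr 1
  · congr 1; ring
  · refine Finset.prod_congr rfl fun j _ => ?_
    have hk : (0 : ℝ) ≤ ((m j).factorial : ℝ)⁻¹ := by positivity
    rw [div_eq_mul_inv, div_eq_mul_inv, suppPow_mul _ (pow_nonneg (hΛ j) _) hk,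
      suppPow_mul _ (pow_nonneg (hΛ' j) _) hk, mul_mul_mul_comm, suppPow_mul_suppPow hk,
      suppPow_pow _ (hΛ j), suppPow_pow _ (hΛ' j), mul_pow, div_eq_mul_inv]

theorem chernoff_poissonDist (hΛ : ∀ j, 0 ≤ Λ j) (hΛ' : ∀ j, 0 ≤ Λ' j) (hΛs : HasSum Λ N)
    (hΛs' : HasSum Λ' N') {s : ℝ} (hs : s ∈ Set.Icc (0 : ℝ) 1) :
    chernoff s (poissonDist Λ) (poissonDist Λ') =
      Real.exp (-(s * N + (1 - s) * N') + chernoff s Λ Λ') := by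
  have h := hasSum_finsupp_prod_pow_div_factorial
    (fun j => mul_nonneg (suppPow_nonneg s (hΛ j)) (suppPow_nonneg (1 - s) (hΛ' j)))
    (summable_chernoff hs hΛ hΛ' hΛs.summable hΛs'.summable).hasSum
  rw [chernoff, tsum_congr (suppPow_poissonDist_mul hΛ hΛ' hΛs hΛs' s), tsum_mul_left, h.tsum_eq,
    ← Real.exp_add, chernoff]

end Poisson

/-! ### Relative entropy from the Chernoff quantity -/

lemma tendsto_div_one_sub_of_hasDerivAt {f : ℝ → ℝ} {f' : ℝ} (hf : HasDerivAt f f' 1)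
    (h1 : f 1 = 0) : Tendsto (fun s => f s / (1 - s)) (𝓝[<] 1) (𝓝 (-f')) := by
  have h := ((hasDerivAt_iff_tendsto_slope.mp hf).mono_left
    (nhdsWithin_mono 1 fun x (hx : x < 1) => hx.ne)).neg
  refine h.congr fun s => ?_
  rw [slope_def_field, h1, sub_zero, ← div_neg, neg_sub]

/-- Each term of the relative entropy, infinite values included, is the limit of difference
quotients of the Chernoff term at `s = 1`. -/
lemma tendsto_relEntropyTerm {p q : ℝ} (hp : 0 ≤ p) (hq : 0 ≤ q) :
    Tendsto (fun s => ENNReal.ofReal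
      ((s * p + (1 - s) * q - suppPow s p * suppPow (1 - s) q) / (1 - s))) (𝓝[<] 1)
      (𝓝 (relEntropyTerm p q)) := by
  by_cases h : q = 0 ∧ p ≠ 0
  · obtain ⟨rfl, hp0⟩ := h
    have hp' : 0 < p := lt_of_le_of_ne hp hp0.symm
    rw [relEntropyTerm, if_pos ⟨rfl, hp0⟩]
    refine ENNReal.tendsto_ofReal_atTop.comp ?_
    simp only [mul_zero, suppPow_zero_right, add_zero, sub_zero, div_eq_mul_inv]
    have h1 : Tendsto (fun s : ℝ => s * p) (𝓝[<] 1) (𝓝 (1 * p)) :=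
      (tendsto_id.mono_left nhdsWithin_le_nhds).mul_const p
    refine h1.pos_mul_atTop (by simpa using hp') (tendsto_inv_nhdsGT_zero.comp ?_)
    refine tendsto_nhdsWithin_iff.mpr ⟨?_, ?_⟩
    · have : Tendsto (fun s : ℝ => 1 - s) (𝓝 1) (𝓝 (1 - 1)) := tendsto_const_nhds.sub tendsto_id
      rw [sub_self] at this
      exact this.mono_left nhdsWithin_le_nhds
    · filter_upwards [self_mem_nhdsWithin] with s hs
      exact sub_pos.mpr (Set.mem_Iio.mp hs)
  · have hpq : p * suppPow 0 q = p := by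
      by_cases hq0 : q = 0
      · simp [hq0, not_not.mp fun hp0 => h ⟨hq0, hp0⟩]
      · simp [suppPow, hq0]
    rw [relEntropyTerm, if_neg h]
    refine ENNReal.tendsto_ofReal ?_
    have hd : HasDerivAt (fun s => s * p + (1 - s) * q - suppPow s p * suppPow (1 - s) q)
        (-(q - p + p * Real.log (p / q))) 1 := by
      have h1 := ((hasDerivAt_id (1 : ℝ)).mul_const p).add
        (((hasDerivAt_id (1 : ℝ)).const_sub 1).mul_const q)
      refine (h1.sub (hasDerivAt_suppPow_mul p q 1 hp hq)).congr_deriv ?_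
      rw [sub_self, suppPow_one, hpq]
      by_cases hp0 : p = 0
      · simp [hp0]
      by_cases hq0 : q = 0
      · exact absurd ⟨hq0, hp0⟩ h
      rw [Real.log_div hp0 hq0]
      ring
    have := tendsto_div_one_sub_of_hasDerivAt hd (by simp [hpq])
    rwa [neg_neg] at this

/-- A bound on the classical Chernoff quantity near `s = 1` gives one on the relative entropy: each
term is a limit as `s ↑ 1`, and the terms are nonnegative. -/
theorem relEntropy_le_of_tendsto {ι : Type*} {p q : ι → ℝ} {a b u : ℝ} {φ : ℝ → ℝ}
    (hp : ∀ i, 0 ≤ p i) (hq : ∀ i, 0 ≤ q i) (hpa : HasSum p a) (hqb : HasSum q b)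
    (hφ : Tendsto φ (𝓝[<] 1) (𝓝 u))
    (h : ∀ s ∈ Set.Ioo (0 : ℝ) 1, (s * a + (1 - s) * b - chernoff s p q) / (1 - s) ≤ φ s) :
    (relEntropy p q : EReal) ≤ u := by
  have hnn : ∀ s ∈ Set.Ioo (0 : ℝ) 1, ∀ i,
      0 ≤ s * p i + (1 - s) * q i - suppPow s (p i) * suppPow (1 - s) (q i) := fun s hs i =>
    sub_nonneg.mpr (suppPow_mul_suppPow_le hs.1.le hs.2.le (hp i) (hq i))
  have hsum : ∀ s ∈ Set.Ioo (0 : ℝ) 1, HasSum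
      (fun i => s * p i + (1 - s) * q i - suppPow s (p i) * suppPow (1 - s) (q i))
      (s * a + (1 - s) * b - chernoff s p q) := fun s hs =>
    ((hpa.mul_left s).add (hqb.mul_left (1 - s))).sub
      (summable_chernoff ⟨hs.1.le, hs.2.le⟩ hp hq hpa.summable hqb.summable).hasSum
  have hev : ∀ᶠ s in 𝓝[<] (1 : ℝ), s ∈ Set.Ioo (0 : ℝ) 1 := Ioo_mem_nhdsLT zero_lt_one
  have hu : 0 ≤ u := by
    refine ge_of_tendsto hφ (hev.mono fun s hs => le_trans ?_ (h s hs))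
    exact div_nonneg ((hsum s hs).nonneg (hnn s hs)) (sub_pos.mpr hs.2).le
  have hle : relEntropy p q ≤ ENNReal.ofReal u := by
    rw [relEntropy, ENNReal.tsum_eq_iSup_sum]
    refine iSup_le fun S => le_of_tendsto_of_tendsto
      (tendsto_finsetSum S fun i _ => tendsto_relEntropyTerm (hp i) (hq i))
      (ENNReal.tendsto_ofReal hφ) (hev.mono fun s hs => ?_)
    have hs1 : 0 < 1 - s := sub_pos.mpr hs.2
    beta_reduce
    rw [← ENNReal.ofReal_sum_of_nonneg fun i _ => div_nonneg (hnn s hs i) hs1.le]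
    refine ENNReal.ofReal_le_ofReal (le_trans ?_ (h s hs))
    rw [← Finset.sum_div]
    exact div_le_div_of_nonneg_right (sum_le_hasSum S (fun i _ => hnn s hs i) (hsum s hs)) hs1.le
  calc (relEntropy p q : EReal) ≤ (ENNReal.ofReal u : EReal) := by exact_mod_cast hle
    _ = u := by rw [EReal.coe_ennreal_ofReal, max_eq_left hu]

section Monotonicity

variable {d J : Type*} [Fintype d] [DecidableEq d] [Countable J] {E : J → Matrix d d ℂ}
  (hE : IsPOVM E) {A B : Matrix d d ℂ} (hA : A.PosSemidef) (hB : B.PosSemidef)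
include hE hA hB

/-- If the gap `s a + (1 - s) b - C_s` of `p`, `q` is at most that of the intensities, then the
relative entropy of `p`, `q` is at most the quantum one. This applies both to the intensities and to
the Poisson distributions. -/
lemma IsPOVM.relEntropy_le_qRelEntropy_of_chernoff {ι : Type*} {p q : ι → ℝ} {a b : ℝ}
    (hp : ∀ i, 0 ≤ p i) (hq : ∀ i, 0 ≤ q i) (hpa : HasSum p a) (hqb : HasSum q b)
    (h : ∀ s ∈ Set.Ioo (0 : ℝ) 1, s * a + (1 - s) * b - chernoff s p q ≤
      s * A.trace.re + (1 - s) * B.trace.re - chernoff s (intensity E A) (intensity E B)) :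
    (relEntropy p q : EReal) ≤ qRelEntropy A B := by
  by_cases hsupp : supp A ≤ supp B
  · have h1 := (supp_le_supp_iff hA hB).mp hsupp
    have hd : HasDerivAt (fun s => s * A.trace.re + (1 - s) * B.trace.re - qChernoff s A B)
        (-(B.trace.re - A.trace.re + (A * (mlog A - mlog B)).trace.re)) 1 := by
      have h2 := ((hasDerivAt_id (1 : ℝ)).mul_const A.trace.re).add
        (((hasDerivAt_id (1 : ℝ)).const_sub 1).mul_const B.trace.re)
      exact (h2.sub (hasDerivAt_qChernoff hA hB h1)).congr_deriv (by ring)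
    have hφ := tendsto_div_one_sub_of_hasDerivAt hd (by simp [h1])
    rw [neg_neg] at hφ
    rw [qRelEntropy_eq_of_supp_le hsupp]
    exact relEntropy_le_of_tendsto hp hq hpa hqb hφ fun s hs =>
      div_le_div_of_nonneg_right ((h s hs).trans (sub_le_sub_left
        (hE.qChernoff_le_chernoff hA hB ⟨hs.1.le, hs.2.le⟩) _)) (sub_pos.mpr hs.2).le
  · rw [qRelEntropy, if_neg hsupp]
    exact le_top

theorem IsPOVM.relEntropy_intensity_le_qRelEntropy :
    (relEntropy (intensity E A) (intensity E B) : EReal) ≤ qRelEntropy A B :=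
  hE.relEntropy_le_qRelEntropy_of_chernoff hA hB (hE.intensity_nonneg hA) (hE.intensity_nonneg hB)
    (hE.hasSum_intensity A) (hE.hasSum_intensity B) fun _ _ => le_rfl

theorem IsPOVM.relEntropy_poissonDist_le_qRelEntropy :
    (relEntropy (poissonDist (intensity E A)) (poissonDist (intensity E B)) : EReal) ≤
      qRelEntropy A B := by
  have hΛ := hE.intensity_nonneg hA
  have hΛ' := hE.intensity_nonneg hB
  have hS := hE.hasSum_intensity A
  have hS' := hE.hasSum_intensity B
  refine hE.relEntropy_le_qRelEntropy_of_chernoff hA hB (poissonDist_nonneg hΛ hS)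
    (poissonDist_nonneg hΛ' hS') (hasSum_poissonDist hΛ hS) (hasSum_poissonDist hΛ' hS')
    fun s hs => ?_
  rw [chernoff_poissonDist hΛ hΛ' hS hS' ⟨hs.1.le, hs.2.le⟩]
  -- `1 - exp (-x) ≤ x`
  have := Real.add_one_le_exp (-(s * A.trace.re + (1 - s) * B.trace.re) +
    chernoff s (intensity E A) (intensity E B))
  linarith

end Monotonicity

end PoissonQuantum

theorem proposition6
    {d : Type*} [Fintype d] [DecidableEq d] {J : Type*} [Countable J]
    -- the two Poisson states: expected object numbers and one-object density operators
    (N N' : ℝ) (hN : 0 ≤ N) (hN' : 0 ≤ N')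
    (τ₁ τ₁' : Matrix d d ℂ) (hτ₁ : IsDensity τ₁) (hτ₁' : IsDensity τ₁')
    -- the measurement
    (E : J → Matrix d d ℂ) (hE : IsPOVM E)
    -- the intensity operators, the intensities and the counting distributions
    (Γ Γ' : Matrix d d ℂ) (hΓ : Γ = intensityOp N τ₁) (hΓ' : Γ' = intensityOp N' τ₁')
    (Λ Λ' : J → ℝ) (hΛ : Λ = intensity E Γ) (hΛ' : Λ' = intensity E Γ')
    (P P' : (J →₀ ℕ) → ℝ) (hP : P = poissonDist Λ) (hP' : P' = poissonDist Λ') :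
    -- monotonicity for the Poisson states, as Poisson limits of the `M`-mode states
    ((∃ F : ℝ, Tendsto (fun M : ℕ => fidelity (rareState N τ₁ M) (rareState N' τ₁' M))
          atTop (𝓝 F) ∧ F ≤ chernoff (1 / 2) P P') ∧
      (∀ s : ℝ, 0 ≤ s → s ≤ 1 → ∃ C : ℝ,
        Tendsto (fun M : ℕ => qChernoff s (rareState N τ₁ M) (rareState N' τ₁' M))
          atTop (𝓝 C) ∧ C ≤ chernoff s P P') ∧
      (∃ D : EReal,
        Tendsto (fun M : ℕ => qRelEntropy (rareState N τ₁ M) (rareState N' τ₁' M))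
          atTop (𝓝 D) ∧ D ≥ (relEntropy P P' : EReal))) ∧
    -- monotonicity for the intensity operators
    (fidelity Γ Γ' ≤ chernoff (1 / 2) Λ Λ' ∧
      (∀ s : ℝ, 0 ≤ s → s ≤ 1 → qChernoff s Γ Γ' ≤ chernoff s Λ Λ') ∧
      qRelEntropy Γ Γ' ≥ (relEntropy Λ Λ' : EReal)) := by
  subst hP hP' hΛ hΛ' hΓ hΓ'
  have hΓ := hτ₁.posSemidef_intensityOp hN
  have hΓ' := hτ₁'.posSemidef_intensityOp hN'
  have hPC : ∀ s ∈ Set.Icc (0 : ℝ) 1, _ := fun s hs =>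
    chernoff_poissonDist (hE.intensity_nonneg hΓ) (hE.intensity_nonneg hΓ')
      (hE.hasSum_intensity (intensityOp N τ₁)) (hE.hasSum_intensity (intensityOp N' τ₁')) hs
  simp only [hτ₁.trace_intensityOp, hτ₁'.trace_intensityOp, Complex.ofReal_re] at hPC
  have hF := hE.fidelity_le_chernoff hΓ hΓ'
  refine ⟨⟨⟨_, tendsto_fidelity_rareState hN hN' hτ₁ hτ₁', ?_⟩, fun s h0 h1 =>
    ⟨_, tendsto_qChernoff_rareState hN hN' hτ₁ hτ₁' s, ?_⟩,
    _, tendsto_qRelEntropy_rareState hN hN' hτ₁ hτ₁',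
    hE.relEntropy_poissonDist_le_qRelEntropy hΓ hΓ'⟩, hF,
    fun s h0 h1 => hE.qChernoff_le_chernoff hΓ hΓ' ⟨h0, h1⟩,
    hE.relEntropy_intensity_le_qRelEntropy hΓ hΓ'⟩
  · rw [hPC _ ⟨by norm_num, by norm_num⟩]
    gcongr
  · rw [hPC _ ⟨h0, h1⟩]
    gcongr
    exact hE.qChernoff_le_chernoff hΓ hΓ' ⟨h0, h1⟩
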